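/- **Setting.** Variables range over $\mathbb Z$. A linear term is $a_1z_1+\dots+a_nz_n+c$ with integer coefficients $a_i$ and integer constant $c$; $\|t\|$ is the largest absolute value of a coefficient or of the constant of $t$, and $\|T\|=\max_{t\in T}\|t\|$ for a finite set $T$ of terms ($\|\emptyset\|=0$). A quantifier-free formula is built from linear inequalities $t<0$ and modulo constraints $t\equiv 0 \bmod q$ ($q\ge 1$) by $\neg,\wedge$; here $\bot$ is $0<0$, $\top$ is $\neg\bot$, $s<t$ is $s-t<0$, $s\le t$ is $\neg(t<s)$, $s=t$ is $s\le t\wedge t\le s$. For such $\varphi$, let $\mathrm{vars}(\varphi)$ be its set of variables, $\mathrm{lin}(\varphi)$ the set of terms $t$ of its inequalities $t<0$, $\mathrm{hom}(\varphi)$ the set of terms obtained from $\mathrm{lin}(\varphi)$ by setting the constants to $0$, and $\mathrm{mod}(\varphi)$ the set of moduli that appear in it ($\operatorname{lcm}\emptyset=1$). The formula $\exists^{\ge x}y\,\varphi$ says that at least $x$ values of $y$ satisfy $\varphi$ ($x\ne y$ variables). The following procedure turns it into a quantifier-free formula $\Psi_5$; $[n]=\{0,\dots,n-1\}$. 1.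 Replace each modulo constraint $t\equiv0\bmod q$ of $\varphi$ that contains a variable by $\bigvee_{r:\mathrm{vars}(t)\to[q]}\bigl(\beta_r\wedge\bigwedge_z z\equiv_q r(z)\bigr)$, where $\beta_r\in\{\top,\bot\}$ is the truth value of $r(t)\equiv_q 0$. Let $\kappa$ be the lcm of the absolute values of the nonzero coefficients of $y$ in $\mathrm{hom}(\varphi)$. Replace each inequality $ay+t<0$, $a\neq0$, by $\mathrm{sgn}(a)y+(\kappa/|a|)t<0$ and each constraint $y\equiv_q r$ by $y\equiv_{\kappa q}\kappa r$, and let $\psi$ be the conjunction of the result with $y\equiv_\kappa 0$. 2. Let $T$ be the set of $y$-free terms $t$ such that $t$, $y-t$ or $-y+t$ is in $\mathrm{lin}(\psi)$, let $\mu=\operatorname{lcm}(\mathrm{mod}(\psi))$ and $Z=\mathrm{vars}(\varphi)$. Enumerate $T\cup\{0\}$ in any way and compute orderings $O_1,\dots,O_o$ of these terms (conjunctions $t_1\lhd_1t_2\wedge t_2\lhd_2t_3\wedge\cdots$ with $\lhd_j\in\{<,=\}$) by inserting the terms one after the other into the orderings found so far, either as a new strict position or at the end of a block of terms asserted equal,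 and keeping the results that are satisfiable over $\mathbb R$. For each $i$ and $r:Z\to[\mu]$ let $\Gamma_{i,r}=O_i\wedge\bigwedge_{z\in Z}z\equiv_\mu r(z)$. 3. For $O_i$, let $t'_1,\dots,t'_\ell$ be the first terms of its blocks, in ascending order. On each of the segments $y<t'_1$; $y=t'_j$; $t'_{j-1}<y<t'_j$; $t'_\ell<y$, replace in $\psi$ all inequalities by the truth values ($\top$ or $\bot$) imposed by $O_i$ and the segment, and all modulo constraints without $y$ by their truth values under $r$. This gives one formula in $y$ per segment; let $S\subseteq\mathbb Z$ be its set of solutions. 4. For $1\le j\le\ell$ let $c_j=1$ if $r(t'_j)\in S$ for the segment $y=t'_j$, and $c_j=0$ otherwise. For $2\le j\le\ell$ and the segment $t'_{j-1}<y<t'_j$ let $p_j=|S\cap[\mu]|$, $\underline u_j=r(t'_{j-1})\bmod\mu$, let $\overline u_j$ be the least integer $>\underline u_j$ congruent to $r(t'_j)$ modulo $\mu$, let $r'_j$ be the number of elements of $S$ strictly between $\underline u_j$ and $\overline u_j$, and $r_j=-p_j(\overline u_j-\underline u_j)+\mu r'_j$. 5. Let $\Psi_5^{i,r}=\top$ if,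 on one of the segments $y<t'_1$, $t'_\ell<y$, the conjunction of the segment with its formula is satisfiable, and otherwise let $\Psi_5^{i,r}$ be $\mu x\le\sum_{j=2}^{\ell}\bigl(p_j(t'_j-t'_{j-1})+r_j\bigr)+\mu\sum_{j=1}^{\ell}c_j$. The output is $\Psi_5=\bigvee_i\bigvee_{r}(\Gamma_{i,r}\wedge\Psi_5^{i,r})$. **Lemma.** There is an absolute constant $C\in\mathbb N$ such that for every quantifier-free $\varphi$ with $d=|\mathrm{vars}(\varphi)|\ge1$, all variables $x\ne y$, and every enumeration of $T\cup\{0\}$ used in step 2, the output $\Psi_5$ of the procedure on $\exists^{\ge x}y\,\varphi$ satisfies $$\mathrm{mod}(\Psi_5)=\{m\}\quad\text{with } m=k\cdot\operatorname{lcm}(\mathrm{mod}(\varphi))\text{ for some }k\in\mathbb N,\ k\le\max(1,\|\mathrm{hom}(\varphi)\|)^{|\mathrm{hom}(\varphi)|},$$ and, with $N=m^2\cdot\max(1,|\mathrm{lin}(\varphi)|)$, $$|\mathrm{lin}(\Psi_5)|\le\max(2,N)^{Cd},\qquad |\mathrm{hom}(\Psi_5)|\le\max(2,N)^{Cd},$$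 $$\|\mathrm{lin}(\Psi_5)\|\le C\,N\cdot\max(1,\|\mathrm{lin}(\varphi)\|),\qquad \|\mathrm{hom}(\Psi_5)\|\le C\,N\cdot\max(1,\|\mathrm{hom}(\varphi)\|).$$ -/

import Mathlib

noncomputable section

namespace Presburger

/-- Linear terms `a₁ z₁ + ⋯ + a_n z_n + c` with integer coefficients; variables are indexed by `ℕ`.
The first component holds the coefficients, the second the constant.  Addition, subtraction and
integer multiples are componentwise. -/
abbrev LinTerm := (ℕ →₀ ℤ) × ℤ

/-- The variable `z` as a linear term. -/
def LinTerm.var (z : ℕ) : LinTerm := (Finsupp.single z 1, 0)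

/-- The integer `c` as a linear term. -/
def LinTerm.cst (c : ℤ) : LinTerm := (0, c)

/-- Value of a term under an integer assignment. -/
def LinTerm.eval (v : ℕ → ℤ) (t : LinTerm) : ℤ := (t.1.sum fun z a => a * v z) + t.2

/-- Value of a term when the variables are interpreted over the reals. -/
def LinTerm.evalReal (v : ℕ → ℝ) (t : LinTerm) : ℝ := (t.1.sum fun z a => (a : ℝ) * v z) + (t.2 : ℝ)

/-- Largest absolute value of a coefficient or of the constant of a term. -/
def LinTerm.norm (t : LinTerm) : ℕ := max (t.1.support.sup fun z => (t.1 z).natAbs) t.2.natAbs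

/-- Largest norm of a term of a finite set of terms. -/
def normInf (T : Finset LinTerm) : ℕ := T.sup LinTerm.norm

/-- Quantifier-free formulae: the closure of the linear inequalities `t < 0` and the modulo
constraints `t ≡ 0 mod q`, `q ≥ 1`, under negation and conjunction. -/
inductive Formula : Type
  | ltZero (t : LinTerm) : Formula
  | modZero (t : LinTerm) (q : ℕ+) : Formula
  | neg (φ : Formula) : Formula
  | conj (φ ψ : Formula) : Formula

namespace Formula

/-- `φ` is satisfied by the integer assignment `v`. -/
def Sat (v : ℕ → ℤ) : Formula → Prop
  | ltZero t => t.eval v < 0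
  | modZero t q => ((q : ℕ) : ℤ) ∣ t.eval v
  | neg φ => ¬ φ.Sat v
  | conj φ ψ => φ.Sat v ∧ ψ.Sat v

/-- The variables of `φ`. -/
def vars : Formula → Finset ℕ
  | ltZero t => t.1.support
  | modZero t _ => t.1.support
  | neg φ => φ.vars
  | conj φ ψ => φ.vars ∪ ψ.vars

/-- The linear terms `t` of the inequalities `t < 0` of `φ`. -/
def lin : Formula → Finset LinTerm
  | ltZero t => {t}
  | modZero _ _ => ∅
  | neg φ => φ.lin
  | conj φ ψ => φ.lin ∪ ψ.lin

/-- The homogeneous terms obtained from `lin φ` by setting the constants to `0`. -/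
def hom (φ : Formula) : Finset LinTerm := φ.lin.image fun t => (t.1, 0)

/-- The moduli that appear in `φ`. -/
def mods : Formula → Finset ℕ
  | ltZero _ => ∅
  | modZero _ q => {(q : ℕ)}
  | neg φ => φ.mods
  | conj φ ψ => φ.mods ∪ ψ.mods

/-! ### Syntactic abbreviations -/

def bot : Formula := ltZero 0

def top : Formula := neg bot

def disj (φ ψ : Formula) : Formula := neg (conj (neg φ) (neg ψ))

/-- `s < t` -/
def ltF (s t : LinTerm) : Formula := ltZero (s - t)

/-- `s ≤ t` -/
def leF (s t : LinTerm) : Formula := neg (ltF t s)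

/-- `s = t` -/
def eqF (s t : LinTerm) : Formula := conj (leF s t) (leF t s)

/-- The simple modulo constraint `z ≡ a mod q`. -/
def congF (z : ℕ) (a : ℤ) (q : ℕ+) : Formula := modZero (LinTerm.var z - LinTerm.cst a) q

open Classical in
/-- The constant `⊤` or `⊥` with the truth value of `p`. -/
def truth (p : Prop) : Formula := if p then top else bot

def conjList : List Formula → Formula
  | [] => top
  | [φ] => φ
  | φ :: ψ :: l => conj φ (conjList (ψ :: l))

def disjList : List Formula → Formula
  | [] => bot
  | [φ] => φ
  | φ :: ψ :: l => disj φ (disjList (ψ :: l))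

end Formula

open Formula

/-- All maps `r : Z → {0, …, m-1}` (extended by `0`), for a list `Z` of distinct variables. -/
def residueMaps (m : ℕ) : List ℕ → List (ℕ → ℤ)
  | [] => [fun _ => 0]
  | z :: Z => (residueMaps m Z).flatMap fun r =>
      (List.range m).map fun a => Function.update r z (a : ℤ)

/-- `⋀_{z ∈ Z} z ≡ r(z) mod m` -/
def residueFormula (m : ℕ+) (r : ℕ → ℤ) (Z : List ℕ) : Formula :=
  conjList (Z.map fun z => congF z (r z) m)

/-! ### Step 1: normalise the coefficients of `y` -/

/-- Translation of `t ≡ 0 mod q` into simple modulo constraints, by guessing the residues of its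
variables.  A constraint without variables is left as it is. -/
def simpleMod (t : LinTerm) (q : ℕ+) : Formula :=
  if t.1 = 0 then modZero t q
  else disjList ((residueMaps q t.1.support.toList).map fun r =>
    conj (truth (((q : ℕ) : ℤ) ∣ t.eval r)) (residueFormula q r t.1.support.toList))

/-- Translate every modulo constraint of a formula. -/
def makeSimple : Formula → Formula
  | ltZero t => ltZero t
  | modZero t q => simpleMod t q
  | neg φ => neg (makeSimple φ)
  | conj φ ψ => conj (makeSimple φ) (makeSimple ψ)

/-- The lcm of the absolute values of the non-zero coefficients of `y` in `hom φ`. -/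
def coeffLcm (y : ℕ) (φ : Formula) : ℕ :=
  ((φ.hom.image fun t => (t.1 y).natAbs).erase 0).lcm id

/-- `a y + t` with `a ≠ 0` is multiplied by `k / |a|`, and then `k y` is replaced by `y`. -/
def scaleTerm (y k : ℕ) (u : LinTerm) : LinTerm :=
  if u.1 y = 0 then u
  else (Finsupp.single y (Int.sign (u.1 y)), 0) +
    ((k : ℤ) / |u.1 y|) • ((u.1.erase y, u.2) : LinTerm)

/-- Apply `scaleTerm` to all inequalities, and replace `y ≡ r mod q` by `y ≡ k r mod k q`. -/
def scaleFormula (y k : ℕ) : Formula → Formula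
  | ltZero u => ltZero (scaleTerm y k u)
  | modZero t q =>
      if t.1 y = 0 then modZero t q
      else modZero (Finsupp.single y 1, (k : ℤ) * t.2) (k * (q : ℕ)).toPNat'
  | neg φ => neg (scaleFormula y k φ)
  | conj φ ψ => conj (scaleFormula y k φ) (scaleFormula y k ψ)

/-- The formula `ψ` such that `∃^{≥x} y φ` becomes `∃^{≥x} y ψ` after normalisation. -/
def normalise (y : ℕ) (φ : Formula) : Formula :=
  conj (congF y 0 (coeffLcm y φ).toPNat') (scaleFormula y (coeffLcm y φ) (makeSimple φ))

/-! ### Step 2: term orderings and residue classes -/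

/-- The `y`-free terms `t` such that `t`, `y - t` or `-y + t` is a term of `ψ`, for a formula `ψ`
in which the coefficients of `y` are `0`, `1` or `-1`. -/
def yFreeTerms (y : ℕ) (ψ : Formula) : Finset LinTerm :=
  ψ.lin.image fun u =>
    if u.1 y = 0 then u else if 0 < u.1 y then LinTerm.var y - u else u + LinTerm.var y

/-- The terms to be ordered: the `y`-free terms of the normalised formula, and `0`. -/
def orderedTerms (y : ℕ) (φ : Formula) : Finset LinTerm :=
  insert 0 (yFreeTerms y (normalise y φ))

/-- An ordering `t₁ ◁₁ t₂ ∧ t₂ ◁₂ t₃ ∧ ⋯` with `◁ᵢ ∈ {<, =}` is stored as the list, in ascending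
order, of its blocks of terms asserted equal. -/
abbrev TermOrdering := List (List LinTerm)

namespace TermOrdering

/-- `t₁ = t₂, t₂ = t₃, …` -/
def eqChain : List LinTerm → List Formula
  | s :: t :: B => eqF s t :: eqChain (t :: B)
  | _ => []

/-- The conjuncts of an ordering. -/
def conjuncts : TermOrdering → List Formula
  | [] => []
  | [B] => eqChain B
  | B :: B' :: O => eqChain B ++ ltF (B.getLastD 0) (B'.headD 0) :: conjuncts (B' :: O)

/-- The ordering as a formula. -/
def toFormula (O : TermOrdering) : Formula := conjList O.conjuncts

/-- The ordering is satisfiable over the reals. -/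
def RealSat (O : TermOrdering) : Prop :=
  ∃ v : ℕ → ℝ, (∀ B ∈ O, ∀ s ∈ B, ∀ t ∈ B, s.evalReal v = t.evalReal v) ∧
    O.Pairwise fun B B' => ∀ s ∈ B, ∀ t ∈ B', s.evalReal v < t.evalReal v

/-- All ways to insert a term into an ordering: as a new block, or into an existing block. -/
def insertions (t : LinTerm) : TermOrdering → List TermOrdering
  | [] => [[[t]]]
  | B :: O => ([t] :: B :: O) :: ((B ++ [t]) :: O) :: (insertions t O).map fun O' => B :: O'

open Classical in
/-- The orderings of a list of terms, built by inserting one term after the other and keeping the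
results that are satisfiable over the reals. -/
def family : List LinTerm → List TermOrdering
  | [] => [[]]
  | t :: L => ((family L).flatMap (insertions t)).filter fun O => RealSat O

/-- The `j`-th of the terms that the ordering asserts pairwise different (counted from `0`):
the first term of the `j`-th block. -/
def rep (O : TermOrdering) (j : ℕ) : LinTerm := (O.getD j []).headD 0

/-- Position of a term, where the block number `j` (counted from `0`) has position `2 j + 1`. -/
def pos (O : TermOrdering) (t : LinTerm) : ℕ := 2 * O.findIdx (fun B => t ∈ B) + 1

end TermOrdering

/-! ### Step 3: split the range of `y` into segments

Let `t₀ < ⋯ < t_{l-1}` be the representatives of the `l` blocks.  The segments are numbered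
`0, …, 2 l`: number `0` is `y < t₀`, number `2 l` is `t_{l-1} < y`, number `2 j + 1` is `y = t_j`,
and number `2 j + 2` with `j + 1 < l` is `t_j < y ∧ y < t_{j+1}`. -/

/-- The formula `ψ` on segment number `s`: inequalities are replaced by the truth values that the
ordering and the segment impose, modulo constraints without `y` by their truth values under `r`. -/
def almostEval (y : ℕ) (O : TermOrdering) (r : ℕ → ℤ) (s : ℕ) : Formula → Formula
  | ltZero u =>
      if u.1 y = 0 then truth (O.pos u < O.pos 0)
      else if 0 < u.1 y then truth (s < O.pos (LinTerm.var y - u))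
      else truth (O.pos (u + LinTerm.var y) < s)
  | modZero t q => if t.1 y = 0 then truth (((q : ℕ) : ℤ) ∣ t.eval r) else modZero t q
  | neg φ => neg (almostEval y O r s φ)
  | conj φ ψ => conj (almostEval y O r s φ) (almostEval y O r s ψ)

/-- The values of `y` that satisfy the almost evaluated formula. -/
def solutions (y : ℕ) (ψ : Formula) (O : TermOrdering) (r : ℕ → ℤ) (s : ℕ) : Set ℤ :=
  {n | (almostEval y O r s ψ).Sat (Function.update r y n)}

/-! ### Step 4: the number of solutions in each segment -/

/-- The almost evaluated formula is satisfiable on one of the two infinite segments. -/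
def InfinitelyMany (y : ℕ) (ψ : Formula) (O : TermOrdering) (r : ℕ → ℤ) : Prop :=
  (∃ v : ℕ → ℤ, (conj (ltF (LinTerm.var y) (O.rep 0)) (almostEval y O r 0 ψ)).Sat v) ∨
  (∃ v : ℕ → ℤ, (conj (ltF (O.rep (O.length - 1)) (LinTerm.var y))
    (almostEval y O r (2 * O.length) ψ)).Sat v)

open Classical in
/-- Number of solutions of the form `y = t_j`. -/
def pointCount (y : ℕ) (ψ : Formula) (O : TermOrdering) (r : ℕ → ℤ) (j : ℕ) : ℤ :=
  if (O.rep j).eval r ∈ solutions y ψ O r (2 * j + 1) then 1 else 0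

/-- Number of solutions in a full period, for the segment `t_j < y < t_{j+1}`. -/
def periodCount (y : ℕ) (m : ℕ) (ψ : Formula) (O : TermOrdering) (r : ℕ → ℤ) (j : ℕ) : ℤ :=
  ((solutions y ψ O r (2 * j + 2) ∩ Set.Ico 0 (m : ℤ)).ncard : ℤ)

/-- The residue of `r(t_j)` modulo `m`. -/
def lowEnd (m : ℕ) (O : TermOrdering) (r : ℕ → ℤ) (j : ℕ) : ℤ := (O.rep j).eval r % (m : ℤ)

/-- The smallest integer that is congruent to `r(t_{j+1})` modulo `m` and greater than
`lowEnd m O r j`. -/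
def highEnd (m : ℕ) (O : TermOrdering) (r : ℕ → ℤ) (j : ℕ) : ℤ :=
  lowEnd m O r j + 1 + ((O.rep (j + 1)).eval r - (lowEnd m O r j + 1)) % (m : ℤ)

/-- The correction `-p (high - low) + m r'`, where `p` is the number of solutions in a period and
`r'` is the number of solutions strictly between `low` and `high`. -/
def correction (y : ℕ) (m : ℕ) (ψ : Formula) (O : TermOrdering) (r : ℕ → ℤ) (j : ℕ) : ℤ :=
  -(periodCount y m ψ O r j * (highEnd m O r j - lowEnd m O r j)) +
    (m : ℤ) * ((solutions y ψ O r (2 * j + 2) ∩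
      Set.Ioo (lowEnd m O r j) (highEnd m O r j)).ncard : ℤ)

/-! ### Step 5: sum up the numbers of solutions -/

/-- The linear term that is `m` times the number of solutions. -/
def totalTerm (y : ℕ) (m : ℕ) (ψ : Formula) (O : TermOrdering) (r : ℕ → ℤ) : LinTerm :=
  (∑ j ∈ Finset.range (O.length - 1),
    (periodCount y m ψ O r j • (O.rep (j + 1) - O.rep j) +
      LinTerm.cst (correction y m ψ O r j))) +
  LinTerm.cst ((m : ℤ) * ∑ j ∈ Finset.range O.length, pointCount y ψ O r j)

open Classical in
/-- The quantifier-free formula that replaces `∃^{≥x} y ψ` for a given ordering and given residues: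
`⊤` if there are infinitely many solutions, and `m x ≤ totalTerm` otherwise. -/
def countFormula (x y : ℕ) (m : ℕ) (ψ : Formula) (O : TermOrdering) (r : ℕ → ℤ) : Formula :=
  if InfinitelyMany y ψ O r then top
  else leF ((m : ℤ) • LinTerm.var x) (totalTerm y m ψ O r)

/-- The output of the quantifier elimination procedure on `∃^{≥x} y φ`, where the list `L`
enumerates the terms to be ordered. -/
def eliminate (x y : ℕ) (φ : Formula) (L : List LinTerm) : Formula :=
  let ψ := normalise y φ
  let m : ℕ := ψ.mods.lcm id
  let Z : List ℕ := φ.vars.toList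
  disjList ((TermOrdering.family L).flatMap fun O =>
    (residueMaps m Z).map fun r =>
      conj (conj O.toFormula (residueFormula m.toPNat' r Z)) (countFormula x y m ψ O r))

end Presburger

end

/-!
The bounds on norms and moduli are read off the procedure. With `κ` the lcm of the coefficients of
`y`, every ordered term is `0` or `c t` with `|c| ≤ κ` for an inequality `a y + t < 0` of the input
(`eq_zero_or_exists_of_mem_orderedTerms`), every modulus of the normalised formula divides
`κ * lcm (mod φ)`, and `m`, the lcm of these moduli, is a multiple of `κ` and of `lcm (mod φ)`
(`exists_lcm_mods_normalise_eq`). A term of the output is a difference of two ordered terms or the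
term `totalTerm - m x` (`exists_of_mem_lin_eliminate`), and the latter has at most `|lin φ|`
summands, in which the factors `p_j` are at most `m` and the corrections at most `m ^ 2`.

The substantial point is that the number of terms is polynomial with an exponent that is linear in
the number `d` of variables. There are `m ^ d` choices of residues, so it suffices to bound the
number of orderings of `n` terms. An ordering that is satisfied by a real assignment `v` is
determined by the set of pairs `(s, t)` of terms with `s < t` under `v`
(`TermOrdering.eq_foldr_insertAt`), that is, by the sign pattern at `v` of the `n ^ 2` affine
functions `s - t`. These functions lie in a space of dimension at most `d + 1`, and a family of
negativity patterns of functions from a `D`-dimensional space shatters no set of more than `D`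
elements (`Finset.Shatters.card_le_finrank`). The Sauer–Shelah lemma therefore bounds the number of
orderings by `(n ^ 2 + 1) ^ (d + 1)` (`TermOrdering.card_family_le`).
-/

/-! ### Sign patterns of functions from a finite-dimensional space -/

/-- The number of subsets of size at most `D` of an `n`-element set is at most `(n + 1) ^ D`. -/
lemma Finset.card_filter_powerset_card_le {α : Type*} [DecidableEq α] (U : Finset α) (D : ℕ) :
    (U.powerset.filter fun A => A.card ≤ D).card ≤ (U.card + 1) ^ D := by
  have hsub : (U.powerset.filter fun A => A.card ≤ D) ⊆
      (Finset.range (D + 1)).biUnion fun k => U.powersetCard k := by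
    intro A hA
    rw [Finset.mem_filter, Finset.mem_powerset] at hA
    simp only [Finset.mem_biUnion, Finset.mem_range, Finset.mem_powersetCard]
    exact ⟨A.card, by omega, hA.1, rfl⟩
  refine (Finset.card_le_card hsub).trans (Finset.card_biUnion_le.trans ?_)
  rw [add_pow]
  refine Finset.sum_le_sum fun k hk => ?_
  have hk' : k ≤ D := by simpa [Nat.lt_succ_iff] using hk
  rw [Finset.card_powersetCard, one_pow, mul_one]
  exact (Nat.choose_le_pow _ _).trans (Nat.le_mul_of_pos_right _ (Nat.choose_pos hk'))

/-- If all sets of a family consist, within `A`, of the indices of the functions that are negative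
at a point, and the functions span a space of dimension at most `D`, then a shattered set `A` has
at most `D` elements: on a set with a nontrivial linear relation, the pattern "negative exactly
where the coefficient is positive" would make the relation evaluate to a negative number. -/
lemma Finset.Shatters.card_le_finrank {α X : Type*} [DecidableEq α] {𝒜 : Finset (Finset α)}
    {A : Finset α} (hA : 𝒜.Shatters A) (f : α → X → ℝ) (W : Submodule ℝ (X → ℝ))
    [FiniteDimensional ℝ W] (hf : ∀ a ∈ A, f a ∈ W)
    (h𝒜 : ∀ u ∈ 𝒜, ∃ x, ∀ a ∈ A, a ∈ u ↔ f a x < 0) : A.card ≤ Module.finrank ℝ W := by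
  by_contra hlt
  have hdep : ¬ LinearIndependent ℝ (fun a : A => (⟨f a, hf a a.2⟩ : W)) := fun h => by
    have := h.fintype_card_le_finrank
    rw [Fintype.card_coe] at this
    exact hlt this
  obtain ⟨g, hg, a₀, ha₀⟩ := Fintype.not_linearIndependent_iff.mp hdep
  have hrel : ∀ x, ∑ a : A, g a * f a x = 0 := fun x => by
    have := congrArg (fun w : W => (w : X → ℝ) x) hg
    simpa [Finset.sum_apply] using this
  -- Replacing `g` by `-g` if necessary, some coefficient is positive.
  obtain ⟨g, hrel, a₀, ha₀⟩ : ∃ g : A → ℝ, (∀ x, ∑ a : A, g a * f a x = 0) ∧ ∃ a, 0 < g a := by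
    rcases lt_or_gt_of_ne ha₀ with h | h
    · exact ⟨-g, fun x => by simpa using hrel x, a₀, by simpa using h⟩
    · exact ⟨g, hrel, a₀, h⟩
  classical
  obtain ⟨u, hu, hut⟩ := hA (t := (Finset.univ.filter fun a : A => 0 < g a).image Subtype.val)
    (fun a ha => by
      obtain ⟨b, -, rfl⟩ := Finset.mem_image.mp ha
      exact b.2)
  obtain ⟨x, hx⟩ := h𝒜 u hu
  have hmem : ∀ a : A, f a x < 0 ↔ 0 < g a := fun a => by
    rw [← hx a a.2]
    have : (a : α) ∈ A ∩ u ↔ 0 < g a := by rw [hut]; simp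
    simpa using this
  have hneg : ∑ a : A, g a * f a x < 0 := by
    refine Finset.sum_neg' (fun a _ => ?_) ⟨a₀, Finset.mem_univ _, ?_⟩
    · rcases lt_or_ge 0 (g a) with h | h
      · exact (mul_neg_of_pos_of_neg h ((hmem a).2 h)).le
      · exact mul_nonpos_of_nonpos_of_nonneg h (not_lt.1 fun h' => h.not_gt ((hmem a).1 h'))
    · exact mul_neg_of_pos_of_neg ha₀ ((hmem a₀).2 ha₀)
  exact hneg.ne (hrel x)

/-- A family of sign patterns on `U` of functions from a space of dimension at most `D` has at most
`(|U| + 1) ^ D` members. -/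
lemma Finset.card_signPatterns_le {α X : Type*} [DecidableEq α] (𝒜 : Finset (Finset α))
    (U : Finset α) (f : α → X → ℝ) (W : Submodule ℝ (X → ℝ)) [FiniteDimensional ℝ W] {D : ℕ}
    (hD : Module.finrank ℝ W ≤ D) (hf : ∀ a ∈ U, f a ∈ W) (hU : ∀ u ∈ 𝒜, u ⊆ U)
    (h𝒜 : ∀ u ∈ 𝒜, ∃ x, ∀ a ∈ U, a ∈ u ↔ f a x < 0) : 𝒜.card ≤ (U.card + 1) ^ D := by
  refine 𝒜.card_le_card_shatterer.trans (le_trans (Finset.card_le_card fun A hA => ?_)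
    (U.card_filter_powerset_card_le D))
  rw [Finset.mem_shatterer] at hA
  obtain ⟨u, hu, hAu⟩ := hA.exists_superset
  have hAU : A ⊆ U := hAu.trans (hU u hu)
  rw [Finset.mem_filter, Finset.mem_powerset]
  refine ⟨hAU, (hA.card_le_finrank f W (fun a ha => hf a (hAU ha)) fun u hu => ?_).trans hD⟩
  obtain ⟨x, hx⟩ := h𝒜 u hu
  exact ⟨x, fun a ha => hx a (hAU ha)⟩

namespace Presburger

open Formula

/-! ### Real term orderings -/

namespace TermOrdering

/-- The real assignment `v` satisfies the ordering `O`. -/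
def RealSatBy (v : ℕ → ℝ) (O : TermOrdering) : Prop :=
  (∀ B ∈ O, ∀ s ∈ B, ∀ t ∈ B, s.evalReal v = t.evalReal v) ∧
    O.Pairwise fun B B' => ∀ s ∈ B, ∀ t ∈ B', s.evalReal v < t.evalReal v

lemma RealSatBy.tail {v : ℕ → ℝ} {B : List LinTerm} {O : TermOrdering}
    (h : RealSatBy v (B :: O)) : RealSatBy v O :=
  ⟨fun B' hB' => h.1 B' (List.mem_cons_of_mem _ hB'), (List.pairwise_cons.1 h.2).2⟩

open Classical in
/-- Insert `t` into an ordering at the place that the strict order `lt` prescribes, comparing `t`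
with the first term of each block. -/
noncomputable def insertAt (lt : LinTerm → LinTerm → Prop) (t : LinTerm) :
    TermOrdering → TermOrdering
  | [] => [[t]]
  | B :: O =>
      if lt t (B.headD 0) then [t] :: B :: O
      else if lt (B.headD 0) t then B :: insertAt lt t O
      else (B ++ [t]) :: O

lemma headD_mem {B : List LinTerm} (hB : B ≠ []) : B.headD 0 ∈ B := by
  cases B with
  | nil => exact absurd rfl hB
  | cons s B => simp

lemma eq_or_mem_of_mem_insertions {t s : LinTerm} {O O' : TermOrdering} {B : List LinTerm}
    (hO' : O' ∈ insertions t O) (hB : B ∈ O') (hs : s ∈ B) : s = t ∨ ∃ B' ∈ O, s ∈ B' := by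
  induction O generalizing O' with
  | nil =>
    simp only [insertions, List.mem_singleton] at hO'
    subst hO'
    simp_all
  | cons B₀ O ih =>
    simp only [insertions, List.mem_cons, List.mem_map] at hO'
    rcases hO' with rfl | rfl | ⟨O'', hO'', rfl⟩
    · rcases List.mem_cons.1 hB with rfl | hB
      · simp_all
      · exact Or.inr ⟨B, hB, hs⟩
    · rcases List.mem_cons.1 hB with rfl | hB
      · rcases List.mem_append.1 hs with h | h
        · exact Or.inr ⟨B₀, by simp, h⟩
        · simp_all
      · exact Or.inr ⟨B, List.mem_cons_of_mem _ hB, hs⟩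
    · rcases List.mem_cons.1 hB with rfl | hB
      · exact Or.inr ⟨B, by simp, hs⟩
      · rcases ih hO'' hB with h | ⟨B', hB', h⟩
        · exact Or.inl h
        · exact Or.inr ⟨B', List.mem_cons_of_mem _ hB', h⟩

lemma exists_mem_of_mem_insertions {t : LinTerm} {O O' : TermOrdering}
    (hO' : O' ∈ insertions t O) : ∃ B ∈ O', t ∈ B := by
  induction O generalizing O' with
  | nil =>
    simp only [insertions, List.mem_singleton] at hO'
    subst hO'
    simp
  | cons B₀ O ih =>
    simp only [insertions, List.mem_cons, List.mem_map] at hO'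
    rcases hO' with rfl | rfl | ⟨O'', hO'', rfl⟩
    · exact ⟨[t], by simp, by simp⟩
    · exact ⟨B₀ ++ [t], by simp, by simp⟩
    · obtain ⟨B, hB, h⟩ := ih hO''
      exact ⟨B, List.mem_cons_of_mem _ hB, h⟩

lemma exists_mem_of_mem_insertions_of_mem {t s : LinTerm} {O O' : TermOrdering} {B : List LinTerm}
    (hO' : O' ∈ insertions t O) (hB : B ∈ O) (hs : s ∈ B) : ∃ B' ∈ O', s ∈ B' := by
  induction O generalizing O' with
  | nil => simp at hB
  | cons B₀ O ih =>
    simp only [insertions, List.mem_cons, List.mem_map] at hO'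
    rcases hO' with rfl | rfl | ⟨O'', hO'', rfl⟩
    · exact ⟨B, List.mem_cons_of_mem _ hB, hs⟩
    · rcases List.mem_cons.1 hB with rfl | hB
      · exact ⟨B ++ [t], by simp, by simp [hs]⟩
      · exact ⟨B, List.mem_cons_of_mem _ hB, hs⟩
    · rcases List.mem_cons.1 hB with rfl | hB
      · exact ⟨B, by simp, hs⟩
      · obtain ⟨B', hB', h⟩ := ih hO'' hB
        exact ⟨B', List.mem_cons_of_mem _ hB', h⟩

lemma ne_nil_of_mem_insertions {t : LinTerm} {O O' : TermOrdering} (hO : ∀ B ∈ O, B ≠ [])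
    (hO' : O' ∈ insertions t O) : ∀ B ∈ O', B ≠ [] := by
  induction O generalizing O' with
  | nil =>
    simp only [insertions, List.mem_singleton] at hO'
    subst hO'
    simp
  | cons B₀ O ih =>
    simp only [insertions, List.mem_cons, List.mem_map] at hO'
    have hO₁ : ∀ B ∈ O, B ≠ [] := fun B hB => hO B (List.mem_cons_of_mem _ hB)
    rcases hO' with rfl | rfl | ⟨O'', hO'', rfl⟩
    · rw [List.forall_mem_cons]
      exact ⟨by simp, hO⟩
    · rw [List.forall_mem_cons]
      exact ⟨by simp, hO₁⟩
    · rw [List.forall_mem_cons]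
      exact ⟨hO B₀ (by simp), ih hO₁ hO''⟩

lemma length_le_of_mem_insertions {t : LinTerm} {O O' : TermOrdering}
    (hO' : O' ∈ insertions t O) : O'.length ≤ O.length + 1 := by
  induction O generalizing O' with
  | nil =>
    simp only [insertions, List.mem_singleton] at hO'
    subst hO'
    simp
  | cons B₀ O ih =>
    simp only [insertions, List.mem_cons, List.mem_map] at hO'
    rcases hO' with rfl | rfl | ⟨O'', hO'', rfl⟩
    · simp
    · simp
    · simpa using ih hO''

/-- A satisfiable result of an insertion was also satisfiable before the insertion. -/
lemma RealSatBy.of_mem_insertions {v : ℕ → ℝ} {t : LinTerm} {O O' : TermOrdering}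
    (hO' : O' ∈ insertions t O) (h : RealSatBy v O') : RealSatBy v O := by
  induction O generalizing O' with
  | nil => exact ⟨by simp, by simp⟩
  | cons B₀ O ih =>
    simp only [insertions, List.mem_cons, List.mem_map] at hO'
    rcases hO' with rfl | rfl | ⟨O'', hO'', rfl⟩
    · exact h.tail
    · refine ⟨List.forall_mem_cons.2 ⟨fun s hs s' hs' => ?_, h.tail.1⟩,
        List.pairwise_cons.2 ⟨fun B hB s hs => ?_, h.tail.2⟩⟩
      · exact h.1 (B₀ ++ [t]) (by simp) s (by simp [hs]) s' (by simp [hs'])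
      · exact (List.pairwise_cons.1 h.2).1 B hB s (by simp [hs])
    · have h' := ih hO'' h.tail
      refine ⟨List.forall_mem_cons.2 ⟨h.1 B₀ (by simp), h'.1⟩,
        List.pairwise_cons.2 ⟨fun B hB s hs s' hs' => ?_, h'.2⟩⟩
      obtain ⟨B', hB', hs''⟩ := exists_mem_of_mem_insertions_of_mem hO'' hB hs'
      exact (List.pairwise_cons.1 h.2).1 B' hB' s hs s' hs''

/-- Among the results of inserting `t`, only the one prescribed by the comparisons under `v` is
satisfied by `v`. -/
lemma eq_insertAt {v : ℕ → ℝ} {lt : LinTerm → LinTerm → Prop} {t : LinTerm} {O O' : TermOrdering}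
    (hO : ∀ B ∈ O, B ≠ [])
    (hlt : ∀ B ∈ O, ∀ s ∈ B, (lt t s ↔ t.evalReal v < s.evalReal v) ∧
      (lt s t ↔ s.evalReal v < t.evalReal v))
    (hO' : O' ∈ insertions t O) (h : RealSatBy v O') : O' = insertAt lt t O := by
  induction O generalizing O' with
  | nil => simpa [insertions, insertAt] using hO'
  | cons B₀ O ih =>
    simp only [insertions, List.mem_cons, List.mem_map] at hO'
    have hhead := headD_mem (hO B₀ (by simp))
    have hcmp := hlt B₀ (by simp) _ hhead
    rcases hO' with rfl | rfl | ⟨O'', hO'', rfl⟩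
    · have := (List.pairwise_cons.1 h.2).1 B₀ (by simp) t (by simp) _ hhead
      rw [insertAt, if_pos (hcmp.1.2 this)]
    · have := h.1 (B₀ ++ [t]) (by simp) t (by simp) (B₀.headD 0)
        (List.mem_append_left _ hhead)
      rw [insertAt, if_neg (by rw [hcmp.1]; exact this.not_lt),
        if_neg (by rw [hcmp.2]; exact this.symm.not_lt)]
    · obtain ⟨B, hB, ht⟩ := exists_mem_of_mem_insertions hO''
      have := (List.pairwise_cons.1 h.2).1 B hB _ hhead t ht
      rw [insertAt, if_neg (by rw [hcmp.1]; exact this.not_gt), if_pos (hcmp.2.2 this),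
        ih (fun B hB => hO B (List.mem_cons_of_mem _ hB))
          (fun B hB => hlt B (List.mem_cons_of_mem _ hB)) hO'' h.tail]

lemma insertAt_mem_insertions (lt : LinTerm → LinTerm → Prop) (t : LinTerm) (O : TermOrdering) :
    insertAt lt t O ∈ insertions t O := by
  induction O with
  | nil => simp [insertions, insertAt]
  | cons B O ih =>
    rw [insertAt]
    split_ifs
    · simp [insertions]
    · simp [insertions, ih]
    · simp [insertions]

lemma RealSatBy.insertAt {v : ℕ → ℝ} {O : TermOrdering} (h : RealSatBy v O)
    (hO : ∀ B ∈ O, B ≠ []) (t : LinTerm) :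
    RealSatBy v (insertAt (fun s s' => s.evalReal v < s'.evalReal v) t O) := by
  induction O with
  | nil =>
    rw [TermOrdering.insertAt]
    refine ⟨List.forall_mem_cons.2 ⟨fun s hs s' hs' => ?_, by simp⟩, by simp⟩
    rw [List.mem_singleton.1 hs, List.mem_singleton.1 hs']
  | cons B O ih =>
    have hhead := headD_mem (hO B (by simp))
    have hB := h.1 B (by simp)
    have hlt := (List.pairwise_cons.1 h.2).1
    rw [TermOrdering.insertAt]
    split_ifs with h₁ h₂
    · refine ⟨List.forall_mem_cons.2 ⟨fun s hs s' hs' => by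
        rw [List.mem_singleton.1 hs, List.mem_singleton.1 hs'], h.1⟩, List.pairwise_cons.2 ⟨?_, h.2⟩⟩
      rintro B' hB' s hs s' hs'
      rw [List.mem_singleton.1 hs]
      rcases List.mem_cons.1 hB' with rfl | hB'
      · rwa [hB s' hs' _ hhead]
      · exact h₁.trans (hlt B' hB' _ hhead s' hs')
    · have h' := ih h.tail fun B hB => hO B (List.mem_cons_of_mem _ hB)
      refine ⟨List.forall_mem_cons.2 ⟨hB, h'.1⟩, List.pairwise_cons.2 ⟨?_, h'.2⟩⟩
      rintro B' hB' s hs s' hs'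
      rcases eq_or_mem_of_mem_insertions (insertAt_mem_insertions _ t O) hB' hs' with
        rfl | ⟨B'', hB'', hs''⟩
      · rwa [hB s hs _ hhead]
      · exact hlt B'' hB'' s hs s' hs''
    · have heq : t.evalReal v = (B.headD 0).evalReal v := le_antisymm (not_lt.1 h₂) (not_lt.1 h₁)
      have hall : ∀ s ∈ B ++ [t], s.evalReal v = (B.headD 0).evalReal v := fun s hs => by
        rcases List.mem_append.1 hs with hs | hs
        · exact hB s hs _ hhead
        · rw [List.mem_singleton.1 hs, heq]
      refine ⟨List.forall_mem_cons.2 ⟨fun s hs s' hs' => (hall s hs).trans (hall s' hs').symm,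
        h.tail.1⟩, List.pairwise_cons.2 ⟨fun B' hB' s hs s' hs' => ?_, h.tail.2⟩⟩
      rw [hall s hs]
      exact hlt B' hB' _ hhead s' hs'

lemma mem_family_cons {t : LinTerm} {L : List LinTerm} {O : TermOrdering} :
    O ∈ family (t :: L) ↔ (∃ O₁ ∈ family L, O ∈ insertions t O₁) ∧ ∃ v, RealSatBy v O := by
  simp only [family, List.mem_filter, List.mem_flatMap, decide_eq_true_eq]
  rfl

lemma ne_nil_of_mem_family {L : List LinTerm} {O : TermOrdering} (hO : O ∈ family L) :
    ∀ B ∈ O, B ≠ [] := by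
  induction L generalizing O with
  | nil => simp_all [family]
  | cons t L ih =>
    obtain ⟨⟨O₁, hO₁, h⟩, -⟩ := mem_family_cons.1 hO
    exact ne_nil_of_mem_insertions (ih hO₁) h

lemma mem_of_mem_family {L : List LinTerm} {O : TermOrdering} (hO : O ∈ family L)
    {B : List LinTerm} (hB : B ∈ O) {s : LinTerm} (hs : s ∈ B) : s ∈ L := by
  induction L generalizing O B with
  | nil => simp_all [family]
  | cons t L ih =>
    obtain ⟨⟨O₁, hO₁, h⟩, -⟩ := mem_family_cons.1 hO
    rcases eq_or_mem_of_mem_insertions h hB hs with rfl | ⟨B', hB', hs'⟩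
    · simp
    · exact List.mem_cons_of_mem _ (ih hO₁ hB' hs')

lemma length_le_of_mem_family {L : List LinTerm} {O : TermOrdering} (hO : O ∈ family L) :
    O.length ≤ L.length := by
  induction L generalizing O with
  | nil => simp_all [family]
  | cons t L ih =>
    obtain ⟨⟨O₁, hO₁, h⟩, -⟩ := mem_family_cons.1 hO
    have h₁ := length_le_of_mem_insertions h
    have h₂ := ih hO₁
    simp only [List.length_cons]
    omega

lemma exists_realSatBy_of_mem_family {L : List LinTerm} {O : TermOrdering} (hO : O ∈ family L) :
    ∃ v, RealSatBy v O := by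
  cases L with
  | nil =>
    simp only [family, List.mem_singleton] at hO
    subst hO
    exact ⟨0, by simp, by simp⟩
  | cons t L => exact (mem_family_cons.1 hO).2

/-- The terms can be ordered by their values under any assignment, e.g. the zero assignment. -/
lemma family_ne_nil (L : List LinTerm) : family L ≠ [] := by
  suffices h : ∃ O ∈ family L, RealSatBy 0 O by
    obtain ⟨O, hO, -⟩ := h
    exact List.ne_nil_of_mem hO
  induction L with
  | nil => exact ⟨[], by simp [family], by simp, by simp⟩
  | cons t L ih =>
    obtain ⟨O, hO, h⟩ := ih
    have h' := h.insertAt (ne_nil_of_mem_family hO) t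
    exact ⟨_, mem_family_cons.2 ⟨⟨O, hO, insertAt_mem_insertions _ t O⟩, _, h'⟩, h'⟩

/-- An ordering of the family is determined by the strict comparisons under a real solution. -/
lemma eq_foldr_insertAt {v : ℕ → ℝ} {lt : LinTerm → LinTerm → Prop} {L : List LinTerm}
    {O : TermOrdering} (hlt : ∀ s ∈ L, ∀ t ∈ L, lt s t ↔ s.evalReal v < t.evalReal v)
    (hO : O ∈ family L) (h : RealSatBy v O) : O = L.foldr (insertAt lt) [] := by
  induction L generalizing O with
  | nil => simpa [family] using hO
  | cons t L ih =>
    obtain ⟨⟨O₁, hO₁, hins⟩, -⟩ := mem_family_cons.1 hO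
    rw [List.foldr_cons, ← ih (fun s hs t ht => hlt s (List.mem_cons_of_mem _ hs) t
      (List.mem_cons_of_mem _ ht)) hO₁ (h.of_mem_insertions hins)]
    refine eq_insertAt (ne_nil_of_mem_family hO₁) (fun B hB s hs => ?_) hins h
    have hs' := List.mem_cons_of_mem t (mem_of_mem_family hO₁ hB hs)
    exact ⟨hlt t (by simp) s hs', hlt s hs' t (by simp)⟩

end TermOrdering

open Classical in
/-- The space of functions of a real assignment that is spanned by the coordinates in `Z` and the
constant function `1`. -/
noncomputable def affineSpan (Z : Finset ℕ) : Submodule ℝ ((ℕ → ℝ) → ℝ) :=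
  Submodule.span ℝ
    ((insert (fun _ => 1) (Z.image fun z (v : ℕ → ℝ) => v z) : Finset ((ℕ → ℝ) → ℝ)) : Set _)

instance finiteDimensional_affineSpan (Z : Finset ℕ) : FiniteDimensional ℝ (affineSpan Z) :=
  FiniteDimensional.span_finset ℝ _

lemma finrank_affineSpan_le (Z : Finset ℕ) : Module.finrank ℝ (affineSpan Z) ≤ Z.card + 1 := by
  classical
  exact (finrank_span_finset_le_card _).trans
    ((Finset.card_insert_le _ _).trans (Nat.succ_le_succ Finset.card_image_le))

lemma evalReal_mem_affineSpan {Z : Finset ℕ} {t : LinTerm} (ht : t.1.support ⊆ Z) :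
    (fun v => t.evalReal v) ∈ affineSpan Z := by
  have : (fun v => t.evalReal v) = (∑ z ∈ t.1.support, (t.1 z : ℝ) • fun v : ℕ → ℝ => v z) +
      (t.2 : ℝ) • fun _ => 1 := by
    ext v
    simp [LinTerm.evalReal, Finsupp.sum, Finset.sum_apply]
  rw [this]
  refine Submodule.add_mem _ (Submodule.sum_mem _ fun z hz => ?_) ?_
  · exact Submodule.smul_mem _ _ (Submodule.subset_span (by
      simp only [Finset.coe_insert, Finset.coe_image]
      exact Or.inr ⟨z, ht hz, rfl⟩))
  · exact Submodule.smul_mem _ _ (Submodule.subset_span (by simp))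

/-- The number of orderings of `n` terms in `d` variables is at most `(n ^ 2 + 1) ^ (d + 1)`: an
ordering is determined by the sign pattern of the pairwise differences of the terms. -/
lemma TermOrdering.card_family_le {L : List LinTerm} {Z : Finset ℕ}
    (hL : ∀ t ∈ L, t.1.support ⊆ Z) :
    (family L).toFinset.card ≤ (L.length ^ 2 + 1) ^ (Z.card + 1) := by
  classical
  let U : Finset (LinTerm × LinTerm) := L.toFinset ×ˢ L.toFinset
  let f : LinTerm × LinTerm → (ℕ → ℝ) → ℝ := fun p v => p.1.evalReal v - p.2.evalReal v
  let 𝒜 : Finset (Finset (LinTerm × LinTerm)) :=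
    U.powerset.filter fun u => ∃ v, ∀ p ∈ U, p ∈ u ↔ f p v < 0
  have hUmem : ∀ {s t}, (s, t) ∈ U ↔ s ∈ L ∧ t ∈ L := by simp [U]
  have hsub : (family L).toFinset ⊆
      𝒜.image fun u => L.foldr (insertAt fun s t => (s, t) ∈ u) [] := by
    intro O hO
    rw [List.mem_toFinset] at hO
    obtain ⟨v, hv⟩ := exists_realSatBy_of_mem_family hO
    refine Finset.mem_image.2 ⟨U.filter fun p => f p v < 0, ?_, ?_⟩
    · exact Finset.mem_filter.2 ⟨by simp, v, fun p hp => by simp [hp]⟩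
    · refine (eq_foldr_insertAt (fun s hs t ht => ?_) hO hv).symm
      rw [Finset.mem_filter, hUmem]
      simp [hs, ht, f]
  have hU : U.card ≤ L.length ^ 2 := by
    rw [Finset.card_product, sq]
    exact Nat.mul_le_mul L.toFinset_card_le L.toFinset_card_le
  calc (family L).toFinset.card ≤ 𝒜.card := (Finset.card_le_card hsub).trans Finset.card_image_le
    _ ≤ (U.card + 1) ^ (Z.card + 1) :=
        𝒜.card_signPatterns_le U f (affineSpan Z) (finrank_affineSpan_le Z)
          (fun p hp => Submodule.sub_mem _
            (evalReal_mem_affineSpan (hL _ (hUmem.1 hp).1))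
            (evalReal_mem_affineSpan (hL _ (hUmem.1 hp).2)))
          (fun u hu => Finset.mem_powerset.1 (Finset.mem_filter.1 hu).1)
          (fun u hu => (Finset.mem_filter.1 hu).2)
    _ ≤ _ := Nat.pow_le_pow_left (Nat.succ_le_succ hU) _

/-! ### Moduli -/

namespace Formula

@[simp] lemma mods_bot : bot.mods = ∅ := rfl

@[simp] lemma mods_top : top.mods = ∅ := rfl

@[simp] lemma lin_bot : bot.lin = {0} := rfl

@[simp] lemma lin_top : top.lin = {0} := rfl

@[simp] lemma mods_truth (p : Prop) : (truth p).mods = ∅ := by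
  unfold truth; split_ifs <;> rfl

@[simp] lemma lin_truth (p : Prop) : (truth p).lin = {0} := by
  unfold truth; split_ifs <;> rfl

lemma mem_mods_conjList {q : ℕ} {l : List Formula} :
    q ∈ (conjList l).mods ↔ ∃ φ ∈ l, q ∈ φ.mods := by
  induction l with
  | nil => simp [conjList]
  | cons φ l ih => cases l with
    | nil => simp [conjList]
    | cons ψ l => rw [conjList, mods, Finset.mem_union, ih]; simp

lemma mem_mods_disjList {q : ℕ} {l : List Formula} :
    q ∈ (disjList l).mods ↔ ∃ φ ∈ l, q ∈ φ.mods := by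
  induction l with
  | nil => simp [disjList]
  | cons φ l ih => cases l with
    | nil => simp [disjList]
    | cons ψ l =>
      rw [disjList, disj, mods, mods, mods, mods, Finset.mem_union, ih]; simp

lemma mem_lin_conjList {u : LinTerm} {l : List Formula} (hu : u ∈ (conjList l).lin) :
    u = 0 ∨ ∃ φ ∈ l, u ∈ φ.lin := by
  induction l with
  | nil => simpa [conjList] using hu
  | cons φ l ih => cases l with
    | nil => exact Or.inr ⟨φ, by simp, hu⟩
    | cons ψ l =>
      rw [conjList, lin, Finset.mem_union] at hu
      rcases hu with hu | hu
      · exact Or.inr ⟨φ, by simp, hu⟩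
      · rcases ih hu with h | ⟨χ, hχ, h⟩
        · exact Or.inl h
        · exact Or.inr ⟨χ, List.mem_cons_of_mem _ hχ, h⟩

lemma mem_lin_disjList {u : LinTerm} {l : List Formula} (hu : u ∈ (disjList l).lin) :
    u = 0 ∨ ∃ φ ∈ l, u ∈ φ.lin := by
  induction l with
  | nil => simpa [disjList] using hu
  | cons φ l ih => cases l with
    | nil => exact Or.inr ⟨φ, by simp, hu⟩
    | cons ψ l =>
      rw [disjList, disj, lin, lin, lin, lin, Finset.mem_union] at hu
      rcases hu with hu | hu
      · exact Or.inr ⟨φ, by simp, hu⟩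
      · rcases ih hu with h | ⟨χ, hχ, h⟩
        · exact Or.inl h
        · exact Or.inr ⟨χ, List.mem_cons_of_mem _ hχ, h⟩

lemma pos_of_mem_mods {φ : Formula} {q : ℕ} (hq : q ∈ φ.mods) : 0 < q := by
  induction φ with
  | ltZero t => simp [mods] at hq
  | modZero t q' =>
    rw [mods, Finset.mem_singleton] at hq
    exact hq ▸ q'.pos
  | neg φ ih => exact ih hq
  | conj φ ψ ihφ ihψ =>
    rw [mods, Finset.mem_union] at hq
    exact hq.elim ihφ ihψ

end Formula

lemma length_residueMaps (m : ℕ) (Z : List ℕ) : (residueMaps m Z).length = m ^ Z.length := by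
  induction Z with
  | nil => simp [residueMaps]
  | cons z Z ih => simp [residueMaps, ih, pow_succ]

lemma residueMaps_ne_nil {m : ℕ} (hm : 0 < m) (Z : List ℕ) : residueMaps m Z ≠ [] := by
  rw [← List.length_pos_iff, length_residueMaps]
  exact Nat.pow_pos hm

lemma mem_mods_residueFormula {m : ℕ+} {r : ℕ → ℤ} {Z : List ℕ} {q : ℕ} :
    q ∈ (residueFormula m r Z).mods ↔ Z ≠ [] ∧ q = m := by
  rw [residueFormula, mem_mods_conjList]
  cases Z with
  | nil => simp
  | cons z Z =>
    simp only [List.mem_map, ne_eq, reduceCtorEq, not_false_eq_true, true_and]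
    constructor
    · rintro ⟨_, ⟨z, -, rfl⟩, h⟩
      simpa [congF, mods] using h
    · rintro rfl
      exact ⟨_, ⟨z, by simp, rfl⟩, by simp [congF, mods]⟩

lemma eq_zero_of_mem_lin_residueFormula {m : ℕ+} {r : ℕ → ℤ} {Z : List ℕ} {u : LinTerm}
    (hu : u ∈ (residueFormula m r Z).lin) : u = 0 := by
  rcases mem_lin_conjList hu with h | ⟨φ, hφ, h⟩
  · exact h
  · obtain ⟨z, -, rfl⟩ := List.mem_map.1 hφ
    simp [congF, lin] at h

lemma mods_simpleMod (t : LinTerm) (q : ℕ+) : (simpleMod t q).mods = {(q : ℕ)} := by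
  rw [simpleMod]
  split_ifs with h
  · rfl
  · have hZ : t.1.support.toList ≠ [] := by simpa using h
    ext d
    rw [mem_mods_disjList, Finset.mem_singleton]
    constructor
    · rintro ⟨φ, hφ, hd⟩
      obtain ⟨r, -, rfl⟩ := List.mem_map.1 hφ
      rw [mods, mods_truth, Finset.empty_union] at hd
      exact (mem_mods_residueFormula.1 hd).2
    · rintro rfl
      obtain ⟨r, hr⟩ := List.exists_mem_of_ne_nil _ (residueMaps_ne_nil q.pos t.1.support.toList)
      refine ⟨_, List.mem_map.2 ⟨r, hr, rfl⟩, ?_⟩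
      rw [mods, mods_truth, Finset.empty_union]
      exact mem_mods_residueFormula.2 ⟨hZ, rfl⟩

lemma mods_makeSimple (φ : Formula) : (makeSimple φ).mods = φ.mods := by
  induction φ with
  | ltZero t => rfl
  | modZero t q => exact mods_simpleMod t q
  | neg φ ih => exact ih
  | conj φ ψ ihφ ihψ => rw [makeSimple, mods, mods, ihφ, ihψ]

lemma exists_dvd_of_mem_mods_scaleFormula {y k : ℕ} (hk : 0 < k) {φ : Formula} {d : ℕ}
    (hd : d ∈ (scaleFormula y k φ).mods) : ∃ q ∈ φ.mods, d ∣ k * q := by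
  induction φ with
  | ltZero t => simp [scaleFormula, mods] at hd
  | modZero t q =>
    rw [scaleFormula] at hd
    refine ⟨q, by simp [mods], ?_⟩
    split_ifs at hd
    · rw [mods, Finset.mem_singleton] at hd
      exact hd ▸ Dvd.intro_left k rfl
    · rw [mods, Finset.mem_singleton, Nat.toPNat'_coe, if_pos (Nat.mul_pos hk q.pos)] at hd
      exact hd ▸ dvd_rfl
  | neg φ ih => exact ih hd
  | conj φ ψ ihφ ihψ =>
    rw [scaleFormula, mods, Finset.mem_union] at hd
    rcases hd with hd | hd
    · obtain ⟨q, hq, h⟩ := ihφ hd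
      exact ⟨q, Finset.mem_union_left _ hq, h⟩
    · obtain ⟨q, hq, h⟩ := ihψ hd
      exact ⟨q, Finset.mem_union_right _ hq, h⟩

lemma exists_mem_mods_scaleFormula_dvd {y k : ℕ} (hk : 0 < k) {φ : Formula} {q : ℕ}
    (hq : q ∈ φ.mods) : ∃ d ∈ (scaleFormula y k φ).mods, q ∣ d := by
  induction φ with
  | ltZero t => simp [mods] at hq
  | modZero t q' =>
    rw [mods, Finset.mem_singleton] at hq
    subst hq
    rw [scaleFormula]
    split_ifs
    · exact ⟨q', by simp [mods], dvd_rfl⟩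
    · refine ⟨k * q', ?_, Dvd.intro_left k rfl⟩
      rw [mods, Finset.mem_singleton, Nat.toPNat'_coe, if_pos (Nat.mul_pos hk q'.pos)]
  | neg φ ih => exact ih hq
  | conj φ ψ ihφ ihψ =>
    rw [mods, Finset.mem_union] at hq
    rw [scaleFormula, mods]
    rcases hq with hq | hq
    · obtain ⟨d, hd, h⟩ := ihφ hq
      exact ⟨d, Finset.mem_union_left _ hd, h⟩
    · obtain ⟨d, hd, h⟩ := ihψ hq
      exact ⟨d, Finset.mem_union_right _ hd, h⟩

lemma coeffLcm_pos (y : ℕ) (φ : Formula) : 0 < coeffLcm y φ := by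
  rw [coeffLcm, Nat.pos_iff_ne_zero, ne_eq, Finset.lcm_eq_zero_iff]
  simp

lemma mods_normalise (y : ℕ) (φ : Formula) :
    (normalise y φ).mods =
      insert (coeffLcm y φ) (scaleFormula y (coeffLcm y φ) (makeSimple φ)).mods := by
  rw [normalise, mods, congF, mods, Nat.toPNat'_coe, if_pos (coeffLcm_pos y φ), Finset.insert_eq]

lemma lcm_mods_normalise_pos (y : ℕ) (φ : Formula) : 0 < (normalise y φ).mods.lcm id := by
  rw [Nat.pos_iff_ne_zero, ne_eq, Finset.lcm_eq_zero_iff]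
  rintro ⟨q, hq, h0⟩
  exact (pos_of_mem_mods (Finset.mem_coe.1 hq)).ne' h0

lemma coeffLcm_dvd_lcm_mods_normalise (y : ℕ) (φ : Formula) :
    coeffLcm y φ ∣ (normalise y φ).mods.lcm id :=
  Finset.dvd_lcm (f := id) (by rw [mods_normalise]; exact Finset.mem_insert_self _ _)

lemma lcm_mods_dvd_lcm_mods_normalise (y : ℕ) (φ : Formula) :
    φ.mods.lcm id ∣ (normalise y φ).mods.lcm id := by
  refine Finset.lcm_dvd fun q hq => ?_
  rw [← mods_makeSimple] at hq
  obtain ⟨d, hd, h⟩ := exists_mem_mods_scaleFormula_dvd (y := y) (coeffLcm_pos y φ) hq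
  refine h.trans (Finset.dvd_lcm (f := id) ?_)
  rw [mods_normalise]
  exact Finset.mem_insert_of_mem hd

lemma lcm_mods_normalise_dvd (y : ℕ) (φ : Formula) :
    (normalise y φ).mods.lcm id ∣ coeffLcm y φ * φ.mods.lcm id := by
  refine Finset.lcm_dvd fun d hd => ?_
  rw [mods_normalise, Finset.mem_insert] at hd
  rcases hd with rfl | hd
  · exact Dvd.intro _ rfl
  · obtain ⟨q, hq, h⟩ := exists_dvd_of_mem_mods_scaleFormula (coeffLcm_pos y φ) hd
    rw [mods_makeSimple] at hq
    exact h.trans (Nat.mul_dvd_mul_left _ (Finset.dvd_lcm (f := id) hq))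

lemma LinTerm.natAbs_coeff_le_norm (t : LinTerm) (z : ℕ) : (t.1 z).natAbs ≤ t.norm := by
  by_cases h : z ∈ t.1.support
  · exact (Finset.le_sup (f := fun z => (t.1 z).natAbs) h).trans (le_max_left _ _)
  · simp [Finsupp.notMem_support_iff.1 h]

lemma LinTerm.natAbs_const_le_norm (t : LinTerm) : t.2.natAbs ≤ t.norm :=
  le_max_right _ _

lemma LinTerm.norm_le_iff {t : LinTerm} {b : ℕ} :
    t.norm ≤ b ↔ (∀ z, (t.1 z).natAbs ≤ b) ∧ t.2.natAbs ≤ b :=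
  ⟨fun h => ⟨fun z => (t.natAbs_coeff_le_norm z).trans h, t.natAbs_const_le_norm.trans h⟩,
    fun h => max_le (Finset.sup_le fun z _ => h.1 z) h.2⟩

/-- An lcm of positive integers is at most their product. -/
lemma coeffLcm_le (y : ℕ) (φ : Formula) :
    coeffLcm y φ ≤ (max 1 (normInf φ.hom)) ^ φ.hom.card := by
  set E := (φ.hom.image fun t => (t.1 y).natAbs).erase 0 with hE
  have hle : ∀ a ∈ E, a ≤ max 1 (normInf φ.hom) := fun a ha => by
    obtain ⟨t, ht, rfl⟩ := Finset.mem_image.1 (Finset.mem_of_mem_erase ha)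
    exact ((t.natAbs_coeff_le_norm y).trans (Finset.le_sup ht)).trans (le_max_right _ _)
  have hpos : 0 < ∏ a ∈ E, a :=
    Finset.prod_pos fun a ha => Nat.pos_of_ne_zero (Finset.ne_of_mem_erase ha)
  calc coeffLcm y φ ≤ ∏ a ∈ E, a :=
        Nat.le_of_dvd hpos (Finset.lcm_dvd fun a ha => Finset.dvd_prod_of_mem _ ha)
    _ ≤ (max 1 (normInf φ.hom)) ^ E.card := Finset.prod_le_pow_card _ _ _ hle
    _ ≤ _ := Nat.pow_le_pow_right (Nat.zero_lt_one.trans_le (le_max_left _ _))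
        ((Finset.card_le_card (Finset.erase_subset _ _)).trans Finset.card_image_le)

/-- The lcm of the moduli of the normalised formula is a multiple of the lcm of the original moduli,
by a factor that divides the lcm of the coefficients of `y`. -/
lemma exists_lcm_mods_normalise_eq (y : ℕ) (φ : Formula) :
    ∃ k ≤ (max 1 (normInf φ.hom)) ^ φ.hom.card,
      (normalise y φ).mods.lcm id = k * φ.mods.lcm id := by
  obtain ⟨k, hk⟩ := lcm_mods_dvd_lcm_mods_normalise y φ
  have hpos : 0 < φ.mods.lcm id * k := hk ▸ lcm_mods_normalise_pos y φ
  refine ⟨k, le_trans (Nat.le_of_dvd (coeffLcm_pos y φ) ?_) (coeffLcm_le y φ), by rw [hk, mul_comm]⟩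
  have h := lcm_mods_normalise_dvd y φ
  rw [hk, mul_comm] at h
  exact Nat.dvd_of_mul_dvd_mul_right (Nat.pos_of_mul_pos_right hpos) h

/-! ### The ordered terms -/

lemma lin_makeSimple_subset (φ : Formula) : (makeSimple φ).lin ⊆ insert 0 φ.lin := by
  induction φ with
  | ltZero t => exact Finset.subset_insert _ _
  | modZero t q =>
    intro u hu
    rw [makeSimple, simpleMod] at hu
    rw [Finset.mem_insert]
    split_ifs at hu with h
    · simp [lin] at hu
    · rcases mem_lin_disjList hu with h | ⟨φ, hφ, h⟩
      · exact Or.inl h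
      · obtain ⟨r, -, rfl⟩ := List.mem_map.1 hφ
        rw [lin, lin_truth, Finset.mem_union, Finset.mem_singleton] at h
        exact Or.inl (h.elim id eq_zero_of_mem_lin_residueFormula)
  | neg φ ih => exact ih
  | conj φ ψ ihφ ihψ =>
    rw [makeSimple, lin, lin]
    refine Finset.union_subset (ihφ.trans ?_) (ihψ.trans ?_)
    · exact Finset.insert_subset_insert _ Finset.subset_union_left
    · exact Finset.insert_subset_insert _ Finset.subset_union_right

lemma lin_scaleFormula (y k : ℕ) (φ : Formula) :
    (scaleFormula y k φ).lin = φ.lin.image (scaleTerm y k) := by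
  induction φ with
  | ltZero t => simp [scaleFormula, lin]
  | modZero t q => rw [scaleFormula]; split_ifs <;> simp [lin]
  | neg φ ih => exact ih
  | conj φ ψ ihφ ihψ => rw [scaleFormula, lin, lin, ihφ, ihψ, Finset.image_union]

/-- The `y`-free term `t` with `u = t`, `u = y - t` or `u = -y + t`. -/
noncomputable def yFreePart (y : ℕ) (u : LinTerm) : LinTerm :=
  if u.1 y = 0 then u else if 0 < u.1 y then LinTerm.var y - u else u + LinTerm.var y

lemma orderedTerms_subset (y : ℕ) (φ : Formula) :
    orderedTerms y φ ⊆
      insert 0 (φ.lin.image fun w => yFreePart y (scaleTerm y (coeffLcm y φ) w)) := by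
  refine Finset.insert_subset (Finset.mem_insert_self _ _) ?_
  change Finset.image (yFreePart y) (normalise y φ).lin ⊆ _
  intro t ht
  obtain ⟨u, hu, rfl⟩ := Finset.mem_image.1 ht
  rw [normalise, lin, congF, lin, Finset.empty_union, lin_scaleFormula] at hu
  obtain ⟨w, hw, rfl⟩ := Finset.mem_image.1 hu
  rcases Finset.mem_insert.1 (lin_makeSimple_subset φ hw) with rfl | hw
  · exact Finset.mem_insert.2 (Or.inl (by simp [yFreePart, scaleTerm]))
  · exact Finset.mem_insert_of_mem (Finset.mem_image.2 ⟨w, hw, rfl⟩)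

lemma card_orderedTerms_le (y : ℕ) (φ : Formula) :
    (orderedTerms y φ).card ≤ φ.lin.card + 1 :=
  (Finset.card_le_card (orderedTerms_subset y φ)).trans
    ((Finset.card_insert_le _ _).trans (Nat.succ_le_succ Finset.card_image_le))

/-- Up to sign, the term to be ordered that comes from an inequality `a y + t < 0` is
`(k / |a|) t` if `a ≠ 0`, and `t` if `a = 0`. -/
lemma exists_yFreePart_scaleTerm_eq (y : ℕ) {k : ℕ} (hk : 0 < k) (w : LinTerm) :
    ∃ c : ℤ, c.natAbs ≤ k ∧ yFreePart y (scaleTerm y k w) = c • ((w.1.erase y, w.2) : LinTerm) := by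
  by_cases h : w.1 y = 0
  · refine ⟨1, hk, ?_⟩
    rw [scaleTerm, if_pos h, yFreePart, if_pos h, one_smul,
      Finsupp.erase_of_notMem_support (Finsupp.notMem_support_iff.2 h)]
  · have habs : ((k : ℤ) / |w.1 y|).natAbs ≤ k := by
      rw [Int.natAbs_ediv_of_nonneg (by positivity)]
      exact (Nat.div_le_self _ _).trans (by simp)
    have hy : (scaleTerm y k w).1 y = Int.sign (w.1 y) := by
      rw [scaleTerm, if_neg h]
      simp
    rcases lt_or_gt_of_ne h with hneg | hpos
    · rw [Int.sign_eq_neg_one_of_neg hneg] at hy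
      refine ⟨_, habs, ?_⟩
      rw [yFreePart, if_neg (by rw [hy]; decide), if_neg (by rw [hy]; decide), scaleTerm, if_neg h,
        Int.sign_eq_neg_one_of_neg hneg, LinTerm.var]
      ext <;> simp
    · rw [Int.sign_eq_one_of_pos hpos] at hy
      refine ⟨-((k : ℤ) / |w.1 y|), by rwa [Int.natAbs_neg], ?_⟩
      rw [yFreePart, if_neg (by rw [hy]; decide), if_pos (by rw [hy]; decide), scaleTerm, if_neg h,
        Int.sign_eq_one_of_pos hpos, LinTerm.var]
      ext <;> simp

lemma eq_zero_or_exists_of_mem_orderedTerms {y : ℕ} {φ : Formula} {t : LinTerm}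
    (ht : t ∈ orderedTerms y φ) :
    t = 0 ∨ ∃ w ∈ φ.lin, ∃ c : ℤ, c.natAbs ≤ coeffLcm y φ ∧
      t = c • ((w.1.erase y, w.2) : LinTerm) := by
  rcases Finset.mem_insert.1 (orderedTerms_subset y φ ht) with h | h
  · exact Or.inl h
  · obtain ⟨w, hw, rfl⟩ := Finset.mem_image.1 h
    exact Or.inr ⟨w, hw, exists_yFreePart_scaleTerm_eq y (coeffLcm_pos y φ) w⟩

lemma support_subset_vars_of_mem_lin {φ : Formula} {t : LinTerm} (ht : t ∈ φ.lin) :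
    t.1.support ⊆ φ.vars := by
  induction φ with
  | ltZero u =>
    rw [lin, Finset.mem_singleton] at ht
    rw [ht, vars]
  | modZero u q => simp [lin] at ht
  | neg φ ih => exact ih ht
  | conj φ ψ ihφ ihψ =>
    rw [lin, Finset.mem_union] at ht
    rcases ht with ht | ht
    · exact (ihφ ht).trans Finset.subset_union_left
    · exact (ihψ ht).trans Finset.subset_union_right

lemma support_subset_vars_of_mem_orderedTerms {y : ℕ} {φ : Formula} {t : LinTerm}
    (ht : t ∈ orderedTerms y φ) : t.1.support ⊆ φ.vars := by
  rcases eq_zero_or_exists_of_mem_orderedTerms ht with rfl | ⟨w, hw, c, -, rfl⟩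
  · simp
  · refine Finset.Subset.trans Finsupp.support_smul ?_
    rw [Finsupp.support_erase]
    exact (Finset.erase_subset _ _).trans (support_subset_vars_of_mem_lin hw)

lemma natAbs_coeff_le_of_mem_orderedTerms {y : ℕ} {φ : Formula} {t : LinTerm}
    (ht : t ∈ orderedTerms y φ) (z : ℕ) :
    (t.1 z).natAbs ≤ coeffLcm y φ * normInf φ.hom := by
  rcases eq_zero_or_exists_of_mem_orderedTerms ht with rfl | ⟨w, hw, c, hc, rfl⟩
  · simp
  · have hw' : (w.1 z).natAbs ≤ normInf φ.hom :=
      (LinTerm.natAbs_coeff_le_norm (w.1, 0) z).trans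
        (Finset.le_sup (f := LinTerm.norm) (Finset.mem_image.2 ⟨w, hw, rfl⟩))
    rw [Prod.smul_fst, Finsupp.smul_apply, smul_eq_mul, Int.natAbs_mul]
    refine Nat.mul_le_mul hc (le_trans ?_ hw')
    rw [Finsupp.erase_apply]
    split_ifs <;> simp

lemma natAbs_const_le_of_mem_orderedTerms {y : ℕ} {φ : Formula} {t : LinTerm}
    (ht : t ∈ orderedTerms y φ) : t.2.natAbs ≤ coeffLcm y φ * normInf φ.lin := by
  rcases eq_zero_or_exists_of_mem_orderedTerms ht with rfl | ⟨w, hw, c, hc, rfl⟩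
  · simp
  · rw [Prod.smul_snd, smul_eq_mul, Int.natAbs_mul]
    exact Nat.mul_le_mul hc
      (w.natAbs_const_le_norm.trans (Finset.le_sup (f := LinTerm.norm) hw))

lemma normInf_hom_le_normInf_lin (φ : Formula) : normInf φ.hom ≤ normInf φ.lin := by
  refine Finset.sup_le fun t ht => ?_
  obtain ⟨w, hw, rfl⟩ := Finset.mem_image.1 ht
  have h : LinTerm.norm (w.1, 0) ≤ w.norm :=
    LinTerm.norm_le_iff.2 ⟨w.natAbs_coeff_le_norm, Nat.zero_le _⟩
  exact h.trans (Finset.le_sup hw)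

/-! ### The terms of the output -/

lemma mem_lin_eqF {u s t : LinTerm} : u ∈ (eqF s t).lin ↔ u = t - s ∨ u = s - t := by
  simp [eqF, leF, ltF, lin]

namespace TermOrdering

lemma exists_sub_of_mem_eqChain {L B : List LinTerm} (hB : ∀ s ∈ B, s ∈ L) {φ : Formula}
    (hφ : φ ∈ eqChain B) {u : LinTerm} (hu : u ∈ φ.lin) : ∃ s ∈ L, ∃ t ∈ L, u = s - t := by
  induction B with
  | nil => simp [eqChain] at hφ
  | cons s B ih => cases B with
    | nil => simp [eqChain] at hφ
    | cons t B =>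
      rw [eqChain, List.mem_cons] at hφ
      rcases hφ with rfl | hφ
      · rcases mem_lin_eqF.1 hu with h | h
        · exact ⟨t, hB t (by simp), s, hB s (by simp), h⟩
        · exact ⟨s, hB s (by simp), t, hB t (by simp), h⟩
      · exact ih (fun s hs => hB s (List.mem_cons_of_mem _ hs)) hφ

lemma exists_sub_of_mem_conjuncts {L : List LinTerm} (h0 : 0 ∈ L) {O : TermOrdering}
    (hO : ∀ B ∈ O, ∀ s ∈ B, s ∈ L) {φ : Formula} (hφ : φ ∈ O.conjuncts) {u : LinTerm}
    (hu : u ∈ φ.lin) : ∃ s ∈ L, ∃ t ∈ L, u = s - t := by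
  induction O with
  | nil => simp [conjuncts] at hφ
  | cons B O ih => cases O with
    | nil => exact exists_sub_of_mem_eqChain (hO B (by simp)) hφ hu
    | cons B' O =>
      rw [conjuncts, List.mem_append, List.mem_cons] at hφ
      rcases hφ with hφ | rfl | hφ
      · exact exists_sub_of_mem_eqChain (hO B (by simp)) hφ hu
      · rw [ltF, lin, Finset.mem_singleton] at hu
        refine ⟨_, ?_, _, ?_, hu⟩
        · rcases List.eq_nil_or_concat B with rfl | ⟨B₁, s, rfl⟩
          · exact h0
          · simpa using hO (B₁ ++ [s]) (by simp) s (by simp)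
        · cases B' with
          | nil => exact h0
          | cons s B' => exact hO (s :: B') (by simp) s (by simp)
      · exact ih (fun B hB => hO B (List.mem_cons_of_mem _ hB)) hφ

lemma rep_mem {L : List LinTerm} (h0 : 0 ∈ L) {O : TermOrdering}
    (hO : ∀ B ∈ O, ∀ s ∈ B, s ∈ L) (j : ℕ) : O.rep j ∈ L := by
  rw [rep]
  rcases lt_or_ge j O.length with hj | hj
  · rw [List.getD_eq_getElem _ _ hj]
    rcases h : O[j] with _ | ⟨s, B⟩
    · exact h0
    · exact hO O[j] (List.getElem_mem hj) s (by simp [h])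
  · rw [List.getD_eq_default _ _ hj]
    exact h0

end TermOrdering

/-- The terms of the output are differences of ordered terms, coming from the orderings, and the
terms `totalTerm - m x`, one for each ordering and each choice of residues. -/
lemma exists_of_mem_lin_eliminate {x y : ℕ} {φ : Formula} {L : List LinTerm} (h0 : 0 ∈ L)
    {u : LinTerm} (hu : u ∈ (eliminate x y φ L).lin) :
    (∃ s ∈ L, ∃ t ∈ L, u = s - t) ∨
      ∃ O ∈ TermOrdering.family L,
        ∃ r ∈ residueMaps ((normalise y φ).mods.lcm id) φ.vars.toList,
          u = totalTerm y ((normalise y φ).mods.lcm id) (normalise y φ) O r -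
            (((normalise y φ).mods.lcm id : ℕ) : ℤ) • LinTerm.var x := by
  have hzero : ∃ s ∈ L, ∃ t ∈ L, (0 : LinTerm) = s - t := ⟨0, h0, 0, h0, by simp⟩
  rcases mem_lin_disjList hu with rfl | ⟨χ, hχ, hu⟩
  · exact Or.inl hzero
  obtain ⟨O, hO, hχ⟩ := List.mem_flatMap.1 hχ
  obtain ⟨r, hr, rfl⟩ := List.mem_map.1 hχ
  rw [lin, lin, Finset.mem_union, Finset.mem_union] at hu
  rcases hu with (hu | hu) | hu
  · rcases mem_lin_conjList hu with rfl | ⟨χ, hχ, hu⟩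
    · exact Or.inl hzero
    · exact Or.inl (TermOrdering.exists_sub_of_mem_conjuncts h0
        (fun B hB s hs => TermOrdering.mem_of_mem_family hO hB hs) hχ hu)
  · rw [eq_zero_of_mem_lin_residueFormula hu]
    exact Or.inl hzero
  · rw [countFormula] at hu
    split_ifs at hu
    · rw [lin_top, Finset.mem_singleton] at hu
      rw [hu]
      exact Or.inl hzero
    · rw [leF, lin, ltF, lin, Finset.mem_singleton] at hu
      exact Or.inr ⟨O, hO, r, hr, hu⟩

namespace TermOrdering

lemma mods_eqChain {B : List LinTerm} {φ : Formula} (hφ : φ ∈ eqChain B) : φ.mods = ∅ := by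
  induction B with
  | nil => simp [eqChain] at hφ
  | cons s B ih => cases B with
    | nil => simp [eqChain] at hφ
    | cons t B =>
      rw [eqChain, List.mem_cons] at hφ
      rcases hφ with rfl | hφ
      · rfl
      · exact ih hφ

lemma mods_of_mem_conjuncts {O : TermOrdering} {φ : Formula} (hφ : φ ∈ O.conjuncts) :
    φ.mods = ∅ := by
  induction O with
  | nil => simp [conjuncts] at hφ
  | cons B O ih => cases O with
    | nil => exact mods_eqChain hφ
    | cons B' O =>
      rw [conjuncts, List.mem_append, List.mem_cons] at hφ
      rcases hφ with hφ | rfl | hφ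
      · exact mods_eqChain hφ
      · rfl
      · exact ih hφ

lemma mods_toFormula (O : TermOrdering) : O.toFormula.mods = ∅ := by
  rw [Finset.eq_empty_iff_forall_notMem]
  intro q hq
  obtain ⟨φ, hφ, hq⟩ := mem_mods_conjList.1 hq
  simp [mods_of_mem_conjuncts hφ] at hq

end TermOrdering

lemma mods_countFormula (x y m : ℕ) (ψ : Formula) (O : TermOrdering) (r : ℕ → ℤ) :
    (countFormula x y m ψ O r).mods = ∅ := by
  rw [countFormula]
  split_ifs <;> rfl

lemma mods_eliminate (x y : ℕ) {φ : Formula} (hφ : φ.vars.Nonempty) (L : List LinTerm) :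
    (eliminate x y φ L).mods = {(normalise y φ).mods.lcm id} := by
  have hm := lcm_mods_normalise_pos y φ
  have hmods : ∀ O r q, q ∈ (conj (conj (TermOrdering.toFormula O)
      (residueFormula ((normalise y φ).mods.lcm id).toPNat' r φ.vars.toList))
      (countFormula x y ((normalise y φ).mods.lcm id) (normalise y φ) O r)).mods ↔
        q = (normalise y φ).mods.lcm id := fun O r q => by
    rw [mods, mods, TermOrdering.mods_toFormula, mods_countFormula, Finset.empty_union,
      Finset.union_empty, mem_mods_residueFormula, Nat.toPNat'_coe, if_pos hm]
    simp [hφ.ne_empty]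
  ext q
  rw [eliminate, mem_mods_disjList, Finset.mem_singleton]
  constructor
  · rintro ⟨χ, hχ, hq⟩
    obtain ⟨O, -, hχ⟩ := List.mem_flatMap.1 hχ
    obtain ⟨r, -, rfl⟩ := List.mem_map.1 hχ
    exact (hmods O r q).1 hq
  · intro hq
    obtain ⟨O, hO⟩ := List.exists_mem_of_ne_nil _ (TermOrdering.family_ne_nil L)
    obtain ⟨r, hr⟩ := List.exists_mem_of_ne_nil _ (residueMaps_ne_nil hm φ.vars.toList)
    exact ⟨_, List.mem_flatMap.2 ⟨O, hO, List.mem_map.2 ⟨r, hr, rfl⟩⟩, (hmods O r q).2 hq⟩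

/-! ### Size of the term that counts the solutions -/

section TotalTerm

variable {y m : ℕ} {ψ : Formula} {O : TermOrdering} {r : ℕ → ℤ}

lemma periodCount_le (j : ℕ) : (periodCount y m ψ O r j).natAbs ≤ m := by
  rw [periodCount, Int.natAbs_natCast]
  refine (Set.ncard_le_ncard Set.inter_subset_right (Set.finite_Ico _ _)).trans ?_
  rw [← Finset.coe_Ico, Set.ncard_coe_finset, Int.card_Ico]
  simp

lemma highEnd_sub_lowEnd_mem (hm : 0 < m) (j : ℕ) :
    0 < highEnd m O r j - lowEnd m O r j ∧ highEnd m O r j - lowEnd m O r j ≤ m := by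
  have hm' : (0 : ℤ) < m := by exact_mod_cast hm
  have h₁ := Int.emod_nonneg ((O.rep (j + 1)).eval r - (lowEnd m O r j + 1)) hm'.ne'
  have h₂ := Int.emod_lt_of_pos ((O.rep (j + 1)).eval r - (lowEnd m O r j + 1)) hm'
  rw [highEnd]
  constructor <;> linarith

lemma correction_natAbs_le (hm : 0 < m) (j : ℕ) : (correction y m ψ O r j).natAbs ≤ m ^ 2 := by
  obtain ⟨h₁, h₂⟩ := highEnd_sub_lowEnd_mem (O := O) (r := r) hm j
  have hp : periodCount y m ψ O r j ≤ m := by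
    have := periodCount_le (y := y) (m := m) (ψ := ψ) (O := O) (r := r) j
    omega
  have hp₀ : 0 ≤ periodCount y m ψ O r j := Int.natCast_nonneg _
  have hc : (solutions y ψ O r (2 * j + 2) ∩
      Set.Ioo (lowEnd m O r j) (highEnd m O r j)).ncard ≤ m := by
    refine (Set.ncard_le_ncard Set.inter_subset_right (Set.finite_Ioo _ _)).trans ?_
    rw [← Finset.coe_Ioo, Set.ncard_coe_finset, Int.card_Ioo]
    omega
  rw [correction]
  set c := (solutions y ψ O r (2 * j + 2) ∩
    Set.Ioo (lowEnd m O r j) (highEnd m O r j)).ncard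
  have hm₀ : (0 : ℤ) ≤ m := Int.natCast_nonneg _
  have hc' : (c : ℤ) ≤ m := by exact_mod_cast hc
  -- Both summands have absolute value at most `m ^ 2`, and their signs are opposite.
  have h₃ := mul_le_mul hp h₂ h₁.le hm₀
  have h₄ := mul_le_mul_of_nonneg_left hc' hm₀
  have h₅ := mul_nonneg hp₀ h₁.le
  have h₆ : (0 : ℤ) ≤ m * c := mul_nonneg hm₀ (Int.natCast_nonneg _)
  zify
  rw [abs_le]
  constructor <;> nlinarith

lemma natAbs_sum_range_le (l b : ℕ) (f : ℕ → ℤ) (hf : ∀ j, (f j).natAbs ≤ b) :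
    (∑ j ∈ Finset.range l, f j).natAbs ≤ l * b := by
  zify
  refine (Finset.abs_sum_le_sum_abs _ _).trans ((Finset.sum_le_card_nsmul _ _ (b : ℤ)
    fun j _ => ?_).trans ?_)
  · rw [Int.abs_eq_natAbs]
    exact_mod_cast hf j
  · simp

lemma natAbs_period_mul_sub_le {a b : ℤ} {c : ℕ} (j : ℕ) (ha : a.natAbs ≤ c) (hb : b.natAbs ≤ c) :
    (periodCount y m ψ O r j * (a - b)).natAbs ≤ m * (c + c) := by
  rw [Int.natAbs_mul]
  exact Nat.mul_le_mul (periodCount_le j) ((Int.natAbs_sub_le _ _).trans (Nat.add_le_add ha hb))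

lemma natAbs_coeff_totalTerm_le {b z : ℕ} (hb : ∀ j, ((O.rep j).1 z).natAbs ≤ b) :
    ((totalTerm y m ψ O r).1 z).natAbs ≤ (O.length - 1) * (m * (b + b)) := by
  have : (totalTerm y m ψ O r).1 z = ∑ j ∈ Finset.range (O.length - 1),
      periodCount y m ψ O r j * ((O.rep (j + 1)).1 z - (O.rep j).1 z) := by
    simp [totalTerm, LinTerm.cst, Prod.fst_sum, Finsupp.finsetSum_apply]
  rw [this]
  exact natAbs_sum_range_le _ _ _ fun j => natAbs_period_mul_sub_le j (hb _) (hb _)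

lemma natAbs_const_totalTerm_le {b : ℕ} (hm : 0 < m) (hb : ∀ j, (O.rep j).2.natAbs ≤ b) :
    (totalTerm y m ψ O r).2.natAbs ≤
      (O.length - 1) * (m * (b + b) + m ^ 2) + m * O.length := by
  have : (totalTerm y m ψ O r).2 = (∑ j ∈ Finset.range (O.length - 1),
      (periodCount y m ψ O r j * ((O.rep (j + 1)).2 - (O.rep j).2) + correction y m ψ O r j)) +
        m * ∑ j ∈ Finset.range O.length, pointCount y ψ O r j := by
    simp [totalTerm, LinTerm.cst, Prod.snd_sum]
  rw [this]
  refine (Int.natAbs_add_le _ _).trans (Nat.add_le_add ?_ ?_)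
  · exact natAbs_sum_range_le _ _ _ fun j => (Int.natAbs_add_le _ _).trans
      (Nat.add_le_add (natAbs_period_mul_sub_le j (hb _) (hb _)) (correction_natAbs_le hm j))
  · rw [Int.natAbs_mul, Int.natAbs_natCast]
    refine Nat.mul_le_mul_left _ ((natAbs_sum_range_le _ 1 _ fun j => ?_).trans (mul_one _).le)
    rw [pointCount]
    split_ifs <;> simp

end TotalTerm

/-! ### Bounds for the output -/

section Bounds

variable {x y : ℕ} {φ : Formula} {L : List LinTerm}

lemma length_le_card_lin (hL : L.Nodup) (hLφ : L.toFinset = orderedTerms y φ) :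
    L.length ≤ φ.lin.card + 1 := by
  rw [← List.toFinset_card_of_nodup hL, hLφ]
  exact card_orderedTerms_le y φ

lemma mem_orderedTerms_iff (hLφ : L.toFinset = orderedTerms y φ) {t : LinTerm} :
    t ∈ L ↔ t ∈ orderedTerms y φ := by
  rw [← hLφ, List.mem_toFinset]

lemma zero_mem_of_toFinset_eq (hLφ : L.toFinset = orderedTerms y φ) : (0 : LinTerm) ∈ L :=
  (mem_orderedTerms_iff hLφ).2 (Finset.mem_insert_self _ _)

/-- The differences of two ordered terms, plus one term for each pair of an ordering and a choice of
residues. -/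
lemma card_lin_eliminate_le (hLφ : L.toFinset = orderedTerms y φ) :
    (eliminate x y φ L).lin.card ≤ L.length ^ 2 +
      (L.length ^ 2 + 1) ^ (φ.vars.card + 1) * ((normalise y φ).mods.lcm id) ^ φ.vars.card := by
  classical
  set m := (normalise y φ).mods.lcm id with hm
  have hsub : (eliminate x y φ L).lin ⊆
      ((L.toFinset ×ˢ L.toFinset).image fun p => p.1 - p.2) ∪
        (((TermOrdering.family L).toFinset ×ˢ (residueMaps m φ.vars.toList).toFinset).image
          fun p => totalTerm y m (normalise y φ) p.1 p.2 - (m : ℤ) • LinTerm.var x) := by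
    intro u hu
    rw [Finset.mem_union]
    rcases exists_of_mem_lin_eliminate (zero_mem_of_toFinset_eq hLφ) hu with
      ⟨s, hs, t, ht, rfl⟩ | ⟨O, hO, r, hr, rfl⟩
    · exact Or.inl (Finset.mem_image.2 ⟨(s, t), by simp [hs, ht], rfl⟩)
    · exact Or.inr (Finset.mem_image.2 ⟨(O, r), Finset.mem_product.2
        ⟨List.mem_toFinset.2 hO, List.mem_toFinset.2 hr⟩, rfl⟩)
  refine (Finset.card_le_card hsub).trans ((Finset.card_union_le _ _).trans (Nat.add_le_add ?_ ?_))
  · refine Finset.card_image_le.trans ?_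
    rw [Finset.card_product, sq]
    exact Nat.mul_le_mul L.toFinset_card_le L.toFinset_card_le
  · refine Finset.card_image_le.trans ?_
    rw [Finset.card_product]
    refine Nat.mul_le_mul (TermOrdering.card_family_le fun t ht =>
      support_subset_vars_of_mem_orderedTerms ((mem_orderedTerms_iff hLφ).1 ht)) ?_
    refine (List.toFinset_card_le _).trans ?_
    rw [length_residueMaps, Finset.length_toList]

/-- The numerical estimate behind the bound on the number of terms. -/
lemma card_bound_le_pow {n m N d : ℕ} (hd : 1 ≤ d) (hn : n ≤ 2 * N) (hm : m ≤ N) :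
    n ^ 2 + (n ^ 2 + 1) ^ (d + 1) * m ^ d ≤ (max 2 N) ^ (12 * d) := by
  set M := max 2 N
  have hM : 2 ≤ M := le_max_left _ _
  have hM₁ : 1 ≤ M := by omega
  have hN : N ≤ M := le_max_right _ _
  have hnM : n ≤ M ^ 2 := by nlinarith
  have hn₂ : n ^ 2 ≤ M ^ 4 := by
    calc n ^ 2 ≤ (M ^ 2) ^ 2 := Nat.pow_le_pow_left hnM 2
      _ = M ^ 4 := by ring
  have hn₃ : n ^ 2 + 1 ≤ M ^ 5 := by
    have : 1 ≤ M ^ 4 := Nat.one_le_pow _ _ hM₁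
    calc n ^ 2 + 1 ≤ M ^ 4 * 2 := by omega
      _ ≤ M ^ 4 * M := Nat.mul_le_mul_left _ hM
      _ = M ^ 5 := by ring
  have h₁ : n ^ 2 ≤ M ^ (11 * d) := hn₂.trans (Nat.pow_le_pow_right hM₁ (by omega))
  have h₂ : (n ^ 2 + 1) ^ (d + 1) * m ^ d ≤ M ^ (11 * d) := by
    calc (n ^ 2 + 1) ^ (d + 1) * m ^ d ≤ (M ^ 5) ^ (d + 1) * M ^ d :=
          Nat.mul_le_mul (Nat.pow_le_pow_left hn₃ _) (Nat.pow_le_pow_left (hm.trans hN) _)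
      _ = M ^ (5 * (d + 1) + d) := by rw [← pow_mul, ← pow_add]
      _ ≤ M ^ (11 * d) := Nat.pow_le_pow_right hM₁ (by omega)
  calc n ^ 2 + (n ^ 2 + 1) ^ (d + 1) * m ^ d ≤ M ^ (11 * d) * 2 := by omega
    _ ≤ M ^ (11 * d) * M := Nat.mul_le_mul_left _ hM
    _ = M ^ (11 * d + 1) := by rw [pow_succ]
    _ ≤ M ^ (12 * d) := Nat.pow_le_pow_right hM₁ (by omega)

/-- The coefficients of ordered terms are at most `m ‖hom φ‖`, and `totalTerm` adds up at most
`|lin φ|` differences of ordered terms, each multiplied by at most `m`; one more summand `N` accounts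
for `m x`. -/
lemma natAbs_coeff_le_of_mem_lin_eliminate (hL : L.Nodup) (hLφ : L.toFinset = orderedTerms y φ)
    {N : ℕ} (hN : N = ((normalise y φ).mods.lcm id) ^ 2 * max 1 φ.lin.card) {u : LinTerm}
    (hu : u ∈ (eliminate x y φ L).lin) (z : ℕ) :
    (u.1 z).natAbs ≤ 3 * N * max 1 (normInf φ.hom) := by
  have hm := lcm_mods_normalise_pos y φ
  have hκ := Nat.le_of_dvd hm (coeffLcm_dvd_lcm_mods_normalise y φ)
  have hlen := length_le_card_lin hL hLφ
  have h0 := zero_mem_of_toFinset_eq hLφ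
  have hu := exists_of_mem_lin_eliminate h0 hu
  generalize (normalise y φ).mods.lcm id = m at *
  set n := max 1 φ.lin.card
  have hn₁ : 1 ≤ n := le_max_left _ _
  have hn₂ : φ.lin.card ≤ n := le_max_right _ _
  set A := max 1 (normInf φ.hom)
  have hA₁ : 1 ≤ A := le_max_left _ _
  have hmN : m * m * n = N := by rw [hN]; ring
  have hcoeff : ∀ t ∈ L, (t.1 z).natAbs ≤ m * A := fun t ht =>
    (natAbs_coeff_le_of_mem_orderedTerms ((mem_orderedTerms_iff hLφ).1 ht) z).trans
      (Nat.mul_le_mul hκ (le_max_right _ _))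
  have hmle : m ≤ N := by
    rw [← hmN, mul_assoc]
    exact Nat.le_mul_of_pos_right _ (Nat.mul_pos hm hn₁)
  rcases hu with ⟨s, hs, t, ht, rfl⟩ | ⟨O, hO, r, hr, rfl⟩
  · have h := Int.natAbs_sub_le (s.1 z) (t.1 z)
    have hs := hcoeff s hs
    have ht := hcoeff t ht
    have hmA := Nat.mul_le_mul_right A hmle
    rw [Prod.fst_sub, Finsupp.sub_apply, mul_assoc]
    omega
  · have hOlen := TermOrdering.length_le_of_mem_family hO
    have htotal := natAbs_coeff_totalTerm_le (y := y) (m := m) (ψ := normalise y φ) (r := r)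
      (z := z) fun j => hcoeff _ (TermOrdering.rep_mem h0
        (fun B hB s hs => TermOrdering.mem_of_mem_family hO hB hs) j)
    have hvar : (((m : ℤ) • LinTerm.var x).1 z).natAbs ≤ m := by
      simp only [LinTerm.var, Prod.smul_fst, Finsupp.smul_apply, Finsupp.single_apply]
      split_ifs <;> simp
    have hsub := Int.natAbs_sub_le ((totalTerm y m (normalise y φ) O r).1 z)
      (((m : ℤ) • LinTerm.var x).1 z)
    have h₁ : (O.length - 1) * (m * (m * A + m * A)) ≤ 2 * N * A := by
      calc (O.length - 1) * (m * (m * A + m * A)) ≤ n * (m * (m * A + m * A)) :=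
            Nat.mul_le_mul_right _ (by omega)
        _ = 2 * N * A := by rw [← hmN]; ring
    have h₂ : m ≤ N * A := hmle.trans (Nat.le_mul_of_pos_right _ hA₁)
    rw [Prod.fst_sub, Finsupp.sub_apply]
    rw [mul_assoc] at h₁ ⊢
    omega

/-- The constants of ordered terms are at most `m ‖lin φ‖`; in `totalTerm`, a segment between two
blocks contributes the corrections, of size at most `m ^ 2`, and a block contributes at most `m`. -/
lemma natAbs_const_le_of_mem_lin_eliminate (hL : L.Nodup) (hLφ : L.toFinset = orderedTerms y φ)
    {N : ℕ} (hN : N = ((normalise y φ).mods.lcm id) ^ 2 * max 1 φ.lin.card) {u : LinTerm}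
    (hu : u ∈ (eliminate x y φ L).lin) :
    u.2.natAbs ≤ 5 * N * max 1 (normInf φ.lin) := by
  have hm := lcm_mods_normalise_pos y φ
  have hκ := Nat.le_of_dvd hm (coeffLcm_dvd_lcm_mods_normalise y φ)
  have hlen := length_le_card_lin hL hLφ
  have h0 := zero_mem_of_toFinset_eq hLφ
  have hu := exists_of_mem_lin_eliminate h0 hu
  generalize (normalise y φ).mods.lcm id = m at *
  set n := max 1 φ.lin.card
  have hn₁ : 1 ≤ n := le_max_left _ _
  have hn₂ : φ.lin.card ≤ n := le_max_right _ _
  set A := max 1 (normInf φ.lin)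
  have hA₁ : 1 ≤ A := le_max_left _ _
  have hmN : m * m * n = N := by rw [hN]; ring
  have hconst : ∀ t ∈ L, t.2.natAbs ≤ m * A := fun t ht =>
    (natAbs_const_le_of_mem_orderedTerms ((mem_orderedTerms_iff hLφ).1 ht)).trans
      (Nat.mul_le_mul hκ (le_max_right _ _))
  have hmle : m ≤ N := by
    rw [← hmN, mul_assoc]
    exact Nat.le_mul_of_pos_right _ (Nat.mul_pos hm hn₁)
  rcases hu with ⟨s, hs, t, ht, rfl⟩ | ⟨O, hO, r, hr, rfl⟩
  · have h := Int.natAbs_sub_le s.2 t.2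
    have hs := hconst s hs
    have ht := hconst t ht
    have hmA := Nat.mul_le_mul_right A hmle
    rw [Prod.snd_sub, mul_assoc]
    omega
  · have hOlen := TermOrdering.length_le_of_mem_family hO
    have htotal := natAbs_const_totalTerm_le (y := y) (ψ := normalise y φ) (r := r) hm
      fun j => hconst _ (TermOrdering.rep_mem h0
        (fun B hB s hs => TermOrdering.mem_of_mem_family hO hB hs) j)
    have hvar : (totalTerm y m (normalise y φ) O r - (m : ℤ) • LinTerm.var x).2 =
        (totalTerm y m (normalise y φ) O r).2 := by simp [LinTerm.var]
    rw [hvar]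
    have h₁ : m * O.length ≤ 2 * N * A := by
      calc m * O.length ≤ m * (2 * n) := Nat.mul_le_mul_left _ (by omega)
        _ ≤ m * (2 * n) * (m * A) := Nat.le_mul_of_pos_right _ (Nat.mul_pos hm hA₁)
        _ = 2 * N * A := by rw [← hmN]; ring
    have h₂ : (O.length - 1) * (m * (m * A + m * A) + m ^ 2) ≤ 3 * N * A := by
      calc (O.length - 1) * (m * (m * A + m * A) + m ^ 2)
          ≤ n * (m * (m * A + m * A) + m ^ 2 * A) :=
            Nat.mul_le_mul (by omega) (Nat.add_le_add_left (Nat.le_mul_of_pos_right _ hA₁) _)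
        _ = 3 * N * A := by rw [← hmN]; ring
    calc _ ≤ 3 * N * A + 2 * N * A := htotal.trans (Nat.add_le_add h₂ h₁)
      _ = 5 * N * A := by ring

end Bounds

end Presburger

theorem mainTheorem4 :
    ∃ C : ℕ, ∀ (φ : Presburger.Formula) (x y : ℕ) (L : List Presburger.LinTerm),
      x ≠ y → φ.vars.Nonempty →
      L.Nodup → L.toFinset = Presburger.orderedTerms y φ →
      ∃ k m N : ℕ,
        k ≤ (max 1 (Presburger.normInf φ.hom)) ^ φ.hom.card ∧
        m = k * φ.mods.lcm id ∧
        N = m ^ 2 * max 1 φ.lin.card ∧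
        (Presburger.eliminate x y φ L).mods = {m} ∧
        (Presburger.eliminate x y φ L).lin.card ≤ (max 2 N) ^ (C * φ.vars.card) ∧
        (Presburger.eliminate x y φ L).hom.card ≤ (max 2 N) ^ (C * φ.vars.card) ∧
        Presburger.normInf (Presburger.eliminate x y φ L).lin ≤
          C * N * max 1 (Presburger.normInf φ.lin) ∧
        Presburger.normInf (Presburger.eliminate x y φ L).hom ≤
          C * N * max 1 (Presburger.normInf φ.hom) := by
  -- The value `12` comes from the exponent in `card_bound_le_pow`; the norm bounds need only `5`.
  refine ⟨12, fun φ x y L _ hφ hL hLφ => ?_⟩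
  obtain ⟨k, hk, hm⟩ := Presburger.exists_lcm_mods_normalise_eq y φ
  have hpos := Presburger.lcm_mods_normalise_pos y φ
  obtain ⟨N, hN⟩ : ∃ N, N = ((Presburger.normalise y φ).mods.lcm id) ^ 2 * max 1 φ.lin.card :=
    ⟨_, rfl⟩
  have hnN : max 1 φ.lin.card ≤ N := hN ▸ Nat.le_mul_of_pos_left _ (Nat.pow_pos hpos)
  have hmN : (Presburger.normalise y φ).mods.lcm id ≤ N := by
    rw [hN, sq, mul_assoc]
    exact Nat.le_mul_of_pos_right _
      (Nat.mul_pos hpos (Nat.zero_lt_one.trans_le (le_max_left _ _)))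
  have hlen := Presburger.length_le_card_lin hL hLφ
  have hcard : (Presburger.eliminate x y φ L).lin.card ≤ (max 2 N) ^ (12 * φ.vars.card) :=
    (Presburger.card_lin_eliminate_le hLφ).trans
      (Presburger.card_bound_le_pow hφ.card_pos (by omega) hmN)
  refine ⟨k, _, N, hk, hm, hN, Presburger.mods_eliminate x y hφ L, hcard,
    Finset.card_image_le.trans hcard, Finset.sup_le fun u hu => ?_, Finset.sup_le fun u hu => ?_⟩
  · have hle : max 1 (Presburger.normInf φ.hom) ≤ max 1 (Presburger.normInf φ.lin) :=
      max_le_max le_rfl (Presburger.normInf_hom_le_normInf_lin φ)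
    refine Presburger.LinTerm.norm_le_iff.2 ⟨fun z => ?_, ?_⟩
    · exact (Presburger.natAbs_coeff_le_of_mem_lin_eliminate hL hLφ hN hu z).trans
        (Nat.mul_le_mul (Nat.mul_le_mul_right _ (by norm_num)) hle)
    · exact (Presburger.natAbs_const_le_of_mem_lin_eliminate hL hLφ hN hu).trans
        (Nat.mul_le_mul_right _ (Nat.mul_le_mul_right _ (by norm_num)))
  · obtain ⟨w, hw, rfl⟩ := Finset.mem_image.1 hu
    refine Presburger.LinTerm.norm_le_iff.2 ⟨fun z => ?_, Nat.zero_le _⟩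
    exact (Presburger.natAbs_coeff_le_of_mem_lin_eliminate hL hLφ hN hw z).trans
      (Nat.mul_le_mul_right _ (Nat.mul_le_mul_right _ (by norm_num)))
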